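/- Let $\Gamma=(m_{i,j})_{i,j\in I}$ be a Coxeter matrix over an arbitrary (not necessarily finite) set $I$. Let $W_\Gamma$ be its Coxeter group, with generators $s_i$ ($i\in I$) and standard length $\ell$. Let $B_\Gamma$ be its Artin–Tits group, generated by $\mathbf s_i$ ($i\in I$) subject to the braid relations $\mathbf s_i\mathbf s_j\mathbf s_i\cdots=\mathbf s_j\mathbf s_i\mathbf s_j\cdots$ ($m_{i,j}$ factors on each side) whenever $m_{i,j}\neq\infty$. A Coxeter matrix is called spherical if its Coxeter group is finite. Let $\tilde I$ be a partition of $I$ into non-empty blocks such that, for every $\alpha\in\tilde I$, the subgroup $W_\alpha=\langle s_i\mid i\in\alpha\rangle$ of $W_\Gamma$ is finite. Let $r_\alpha$ be the unique element of maximal length in $W_\alpha$, and let $\mathbf r_\alpha\in B_\Gamma$ be the element obtained by replacing each $s_i$ by $\mathbf s_i$ in a reduced expression of $r_\alpha$ (it does not depend on the expression). Let $\tilde W=\langle r_\alpha\mid\alpha\in\tilde I\rangle\subseteq W_\Gamma$. The type of $\tilde I$ is the Coxeter matrix $\tilde\Gamma=(|r_\alpha r_\beta|)_{\alpha,\beta\in\tilde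 I}$ of the orders of the products $r_\alpha r_\beta$ in $W_\Gamma$. The partition $\tilde I$ is called admissible if, for all $w\in\tilde W$ and $\alpha\in\tilde I$, either $\ell(ws_i)=\ell(w)+1$ for all $i\in\alpha$, or $\ell(ws_i)=\ell(w)-1$ for all $i\in\alpha$. **Theorem.** If $\tilde I$ is admissible and its type $\tilde\Gamma$ is spherical, then the map $\mathbf s_\alpha\mapsto\mathbf r_\alpha$ ($\alpha\in\tilde I$) extends to a group homomorphism $\varphi_{\mathrm{gr}}:B_{\tilde\Gamma}\to B_\Gamma$, and this homomorphism is injective. In other words, the subgroup $\tilde B=\langle\mathbf r_\alpha\mid\alpha\in\tilde I\rangle$ of $B_\Gamma$, with the generators $\mathbf r_\alpha$, is the Artin–Tits system of type $\tilde\Gamma$: there is an isomorphism $B_{\tilde\Gamma}\to\tilde B$ sending $\mathbf s_\alpha$ to $\mathbf r_\alpha$ for every $\alpha\in\tilde I$. -/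

import Mathlib

noncomputable section

namespace CoxeterSystem

/-! ### Auxiliary facts: exchange property, distinctness of the simple reflections -/

section Exchange

variable {B W : Type*} [Group W] {M : CoxeterMatrix B} (cs : CoxeterSystem M W)

open Classical in
/-- The elementary step of the permutation action of `W` on `W × ℤ/2`. -/
def stepEnd (i : B) : Function.End (W × ZMod 2) := fun p =>
  (cs.simple i * p.1 * cs.simple i, p.2 + if p.1 = cs.simple i then 1 else 0)

open Classical in
theorem prod_stepEnd (ω : List B) (t : W) (e : ZMod 2) :
    (ω.map cs.stepEnd).prod (t, e) =
      (cs.wordProd ω * t * (cs.wordProd ω)⁻¹, e + ((cs.rightInvSeq ω).count t : ZMod 2)) := by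
  induction ω with
  | nil =>
    show (t, e) = _
    simp
  | cons i ω ih =>
    rw [List.map_cons, List.prod_cons]
    show cs.stepEnd i ((ω.map cs.stepEnd).prod (t, e)) = _
    rw [ih]
    simp only [stepEnd, rightInvSeq, wordProd_cons, List.count_cons, mul_inv_rev, inv_simple]
    refine Prod.ext (by simp only [mul_assoc]) ?_
    have h : (cs.wordProd ω * t * (cs.wordProd ω)⁻¹ = cs.simple i) ↔
        ((cs.wordProd ω)⁻¹ * cs.simple i * cs.wordProd ω = t) := by
      constructor
      · intro h; rw [← h]; group
      · intro h; rw [← h]; group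
    simp only [h, beq_iff_eq]
    split_ifs <;> push_cast <;> ring

theorem reverse_alternatingWord_two_mul (i j : B) (p : ℕ) :
    (alternatingWord i j (2 * p)).reverse = alternatingWord j i (2 * p) := by
  apply List.ext_getElem (by simp)
  intro n h1 h2
  simp only [List.length_reverse, length_alternatingWord] at h1
  rw [List.getElem_reverse, getElem_alternatingWord _ _ _ _ (by simp; omega),
    getElem_alternatingWord _ _ _ _ (by omega)]
  simp only [length_alternatingWord]
  have : Even (2 * p + (2 * p - 1 - n)) ↔ ¬ Even (2 * p + n) := by
    rw [show 2 * p + (2 * p - 1 - n) = 2 * (2 * p - 1 - n) + (n + 1) by omega]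
    simp [Nat.even_add_one, parity_simps]
  by_cases h : Even (2 * p + n) <;> simp [this, h]

open Classical in
theorem even_count_rightInvSeq_alternatingWord (i j : B) (t : W) :
    ((cs.rightInvSeq (alternatingWord i j (2 * M i j))).count t : ZMod 2) = 0 := by
  rw [← reverse_alternatingWord_two_mul, rightInvSeq_reverse, List.count_reverse]
  set l := cs.leftInvSeq (alternatingWord j i (2 * M i j)) with hl
  have hlen : l.length = 2 * M i j := by simp [hl]
  have : l.take (M i j) = l.drop (M i j) := by
    apply List.ext_getElem (by simp [hlen]; omega)
    intro n h1 h2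
    simp only [List.length_take, hlen] at h1
    rw [List.getElem_take, List.getElem_drop]
    simp only [hl]
    rw [getElem_leftInvSeq_alternatingWord _ _ _ _ _ (by omega),
      getElem_leftInvSeq_alternatingWord _ _ _ _ _ (by omega)]
    rw [prod_alternatingWord_eq_mul_pow, prod_alternatingWord_eq_mul_pow]
    have e1 : (2 * n + 1) / 2 = n := by omega
    have e2 : (2 * (M i j + n) + 1) / 2 = M i j + n := by omega
    rw [e1, e2, pow_add, simple_mul_simple_pow]
    simp
  rw [← List.take_append_drop (M i j) l, List.count_append, this]
  push_cast
  exact CharTwo.add_self_eq_zero _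

theorem isLiftable_stepEnd : M.IsLiftable cs.stepEnd := by
  classical
  intro i j
  have h : (cs.stepEnd i * cs.stepEnd j) ^ M i j =
      ((alternatingWord i j (2 * M i j)).map cs.stepEnd).prod := by
    generalize M i j = m
    induction m with
    | zero => simp [alternatingWord]
    | succ m ih =>
      rw [pow_succ, ih, show 2 * (m + 1) = 2 * m + 1 + 1 by ring, alternatingWord_succ,
        alternatingWord_succ]
      simp
  rw [h]
  funext ⟨t, e⟩
  rw [prod_stepEnd, even_count_rightInvSeq_alternatingWord]
  show _ = (t, e)
  have : cs.wordProd (alternatingWord i j (2 * M i j)) = 1 := by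
    rw [prod_alternatingWord_eq_mul_pow]; simp
  simp [this]

/-- The parity of the number of occurrences of `t` in the right inversion sequence of a word
for `w`. -/
def invParity (w t : W) : ZMod 2 := (cs.lift ⟨cs.stepEnd, cs.isLiftable_stepEnd⟩ w (t, 0)).2

theorem lift_stepEnd_wordProd (ω : List B) :
    cs.lift ⟨cs.stepEnd, cs.isLiftable_stepEnd⟩ (cs.wordProd ω) = (ω.map cs.stepEnd).prod := by
  rw [wordProd, map_list_prod, List.map_map]
  congr 2
  funext i
  exact cs.lift_apply_simple cs.isLiftable_stepEnd i

open Classical in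
theorem invParity_wordProd (ω : List B) (t : W) :
    cs.invParity (cs.wordProd ω) t = ((cs.rightInvSeq ω).count t : ZMod 2) := by
  rw [invParity, lift_stepEnd_wordProd, prod_stepEnd]
  simp

theorem invParity_mul (w u t : W) :
    cs.invParity (w * u) t = cs.invParity u t + cs.invParity w (u * t * u⁻¹) := by
  classical
  obtain ⟨ω, rfl⟩ := cs.wordProd_surjective w
  obtain ⟨υ, rfl⟩ := cs.wordProd_surjective u
  have h : cs.invParity (cs.wordProd ω * cs.wordProd υ) t =
      ((ω.map cs.stepEnd).prod ((υ.map cs.stepEnd).prod (t, 0))).2 := by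
    rw [invParity, map_mul, lift_stepEnd_wordProd, lift_stepEnd_wordProd]
    rfl
  rw [h]
  simp only [prod_stepEnd, invParity_wordProd]
  ring

theorem invParity_one (t : W) : cs.invParity 1 t = 0 := by
  have := cs.invParity_wordProd [] t
  simpa using this

theorem invParity_self {t : W} (ht : cs.IsReflection t) : cs.invParity t t = 1 := by
  obtain ⟨v, i, rfl⟩ := ht
  set t := v * cs.simple i * v⁻¹ with ht
  have h0 : cs.invParity (v * v⁻¹) t = 0 := by rw [mul_inv_cancel, invParity_one]
  have hs : cs.invParity (cs.simple i) (cs.simple i) = 1 := by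
    have := cs.invParity_wordProd [i] (cs.simple i)
    simpa using this
  have e : v⁻¹ * t * v⁻¹⁻¹ = cs.simple i := by rw [ht]; group
  rw [invParity_mul, e] at h0
  conv_lhs => rw [ht]
  rw [invParity_mul, e, invParity_mul]
  simp only [simple_mul_simple_self, one_mul, inv_simple, hs]
  rw [← ht]
  linear_combination h0

theorem length_mul_lt_of_invParity_ne_zero {w t : W} (h : cs.invParity w t ≠ 0) :
    cs.length (w * t) < cs.length w := by
  classical
  obtain ⟨ω, hω, rfl⟩ := cs.exists_isReduced w
  rw [invParity_wordProd] at h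
  have : t ∈ cs.rightInvSeq ω := by
    by_contra hn
    exact h (by rw [List.count_eq_zero_of_not_mem hn]; simp)
  exact (cs.isRightInversion_of_mem_rightInvSeq hω this).2

theorem invParity_ne_zero_of_length_mul_le {w t : W} (ht : cs.IsReflection t)
    (h : cs.length (w * t) ≤ cs.length w) : cs.invParity w t ≠ 0 := by
  intro h0
  have h1 : cs.invParity (w * t) t ≠ 0 := by
    rw [invParity_mul, cs.invParity_self ht]
    simp [h0]
  have := cs.length_mul_lt_of_invParity_ne_zero h1
  rw [mul_assoc, ht.mul_self, mul_one] at this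
  omega

/-- The exchange property. -/
theorem exists_eraseIdx_of_length_mul_le {t : W} (ht : cs.IsReflection t) (ω : List B)
    (h : cs.length (cs.wordProd ω * t) ≤ cs.length (cs.wordProd ω)) :
    ∃ k < ω.length, cs.wordProd ω * t = cs.wordProd (ω.eraseIdx k) ∧
      t = (cs.wordProd (ω.drop (k + 1)))⁻¹ * ((ω[k]?.map cs.simple).getD 1) *
        cs.wordProd (ω.drop (k + 1)) := by
  classical
  have h1 := cs.invParity_ne_zero_of_length_mul_le ht h
  rw [invParity_wordProd] at h1
  have hm : t ∈ cs.rightInvSeq ω := by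
    by_contra hn
    exact h1 (by rw [List.count_eq_zero_of_not_mem hn]; simp)
  obtain ⟨k, hk, rfl⟩ := List.mem_iff_getElem.mp hm
  refine ⟨k, by simpa using hk, ?_, ?_⟩
  · rw [← wordProd_mul_getD_rightInvSeq, List.getD_eq_getElem _ 1 hk]
  · rw [← List.getD_eq_getElem _ 1 hk, getD_rightInvSeq]

end Exchange

section Distinct

variable {B W : Type*} [Group W] {M : CoxeterMatrix B} (cs : CoxeterSystem M W)

/-- The linear forms of the geometric representation. -/
def geomForm (M : CoxeterMatrix B) (i : B) : Module.Dual ℝ (B →₀ ℝ) :=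
  Finsupp.linearCombination ℝ fun j => -2 * Real.cos (Real.pi / M i j)

theorem geomForm_single (M : CoxeterMatrix B) (i j : B) :
    geomForm M i (Finsupp.single j 1) = -2 * Real.cos (Real.pi / M i j) := by
  simp [geomForm]

theorem geomForm_self (M : CoxeterMatrix B) (i : B) :
    geomForm M i (Finsupp.single i 1) = 2 := by
  simp [geomForm_single]

/-- The reflections of the geometric representation. -/
def geomReflection (M : CoxeterMatrix B) (i : B) : (B →₀ ℝ) ≃ₗ[ℝ] (B →₀ ℝ) :=
  Module.reflection (geomForm_self M i)

theorem reflection_mul_reflection_sq {V : Type*} [AddCommGroup V] [Module ℝ V] {x y : V}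
    {f g : Module.Dual ℝ V} (hf : f x = 2) (hg : g y = 2) (hy : f y = 0) (hx : g x = 0) :
    (Module.reflection hf * Module.reflection hg) ^ 2 = 1 := by
  ext1 v
  rw [Module.reflection_mul_reflection_pow_apply hf hg 2 v (-2) (by rw [hy, hx]; norm_num)]
  simp [hx, hy]
  module

theorem isLiftable_geomReflection (M : CoxeterMatrix B) : M.IsLiftable (geomReflection M) := by
  intro i j
  rcases eq_or_ne i j with rfl | hij
  · rw [M.diagonal, pow_one]
    ext1 v
    exact Module.involutive_reflection (geomForm_self M i) v
  · have hm1 : M i j ≠ 1 := M.off_diagonal i j hij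
    have ht : geomForm M i (Finsupp.single j 1) * geomForm M j (Finsupp.single i 1) - 2 =
        2 * Real.cos (2 * Real.pi / M i j) := by
      rw [geomForm_single, geomForm_single, M.symmetric j i, mul_div_assoc, Real.cos_two_mul]
      ring
    have hS := Polynomial.Chebyshev.S_two_mul_real_cos (2 * Real.pi / M i j)
    set m := M i j with hm
    rcases Nat.eq_zero_or_pos m with h0 | h0
    · simp [h0]
    rcases eq_or_ne m 2 with h2 | h2
    · have hf : geomForm M i (Finsupp.single j 1) = 0 := by
        rw [geomForm_single, ← hm, h2]; simp
      have hg : geomForm M j (Finsupp.single i 1) = 0 := by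
        rw [geomForm_single, M.symmetric j i, ← hm, h2]; simp
      rw [h2]
      exact reflection_mul_reflection_sq _ _ hf hg
    have hpi : (0 : ℝ) < 2 * Real.pi / m := by positivity
    have hlt : 2 * Real.pi / m < Real.pi := by
      rw [div_lt_iff₀ (by positivity)]
      have : (3 : ℝ) ≤ m := by exact_mod_cast (by omega : 3 ≤ m)
      nlinarith [Real.pi_pos]
    have hsin := (Real.sin_pos_of_pos_of_lt_pi hpi hlt).ne'
    have hmR : (m : ℝ) ≠ 0 := by positivity
    ext1 v
    rw [geomReflection, geomReflection]
    rw [Module.reflection_mul_reflection_pow_apply _ _ m v _ ht.symm]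
    obtain ⟨k, hk | hk⟩ := Nat.even_or_odd' m
    · have e1 : ((m : ℤ) - 2) / 2 = k - 1 := by omega
      have e2 : ((m : ℤ) - 1) / 2 = k - 1 := by omega
      have z : (Polynomial.Chebyshev.S ℝ (k - 1)).eval (2 * Real.cos (2 * Real.pi / m)) = 0 := by
        apply (mul_eq_zero.mp _).resolve_right hsin
        rw [hS]
        have : ((((k : ℤ) - 1 : ℤ) : ℝ) + 1) * (2 * Real.pi / m) = Real.pi := by
          have : (m : ℝ) = 2 * k := by exact_mod_cast hk
          push_cast
          field_simp
          rw [this]; ring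
        rw [this, Real.sin_pi]
      rw [e1, e2, z]
      simp
    · have e1 : ((m : ℤ) - 2) / 2 = k - 1 := by omega
      have e2 : ((m : ℤ) - 1) / 2 = k := by omega
      have e3 : ((m : ℤ) - 3) / 2 = k - 1 := by omega
      have e4 : (m : ℤ) / 2 = k := by omega
      have z : (Polynomial.Chebyshev.S ℝ k).eval (2 * Real.cos (2 * Real.pi / m)) +
          (Polynomial.Chebyshev.S ℝ (k - 1)).eval (2 * Real.cos (2 * Real.pi / m)) = 0 := by
        apply (mul_eq_zero.mp _).resolve_right hsin
        rw [add_mul, hS, hS]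
        have : (((k : ℤ) : ℝ) + 1) * (2 * Real.pi / m) =
            2 * Real.pi - (((k : ℤ) - 1 : ℤ) + 1 : ℝ) * (2 * Real.pi / m) := by
          have : (m : ℝ) = 2 * k + 1 := by exact_mod_cast hk
          push_cast
          field_simp
          rw [this]; ring
        rw [this, Real.sin_two_pi_sub]
        ring
      rw [e1, e2, e3, e4, z]
      simp

theorem simple_injective : Function.Injective cs.simple := by
  classical
  intro i j h
  by_contra hij
  have h1 : geomReflection M i = geomReflection M j := by
    rw [← cs.lift_apply_simple (isLiftable_geomReflection M), h, cs.lift_apply_simple]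
  have h2 := congrArg (fun f => f (Finsupp.single i 1) i) h1
  simp only [geomReflection, Module.reflection_apply, geomForm_self] at h2
  simp [Ne.symm hij] at h2

end Distinct

section Parabolic

variable {B W : Type*} [Group W] {M : CoxeterMatrix B} (cs : CoxeterSystem M W)

/-- The standard parabolic subgroup generated by the simple reflections indexed by `J`. -/
def parabolic (J : Set B) : Subgroup W := Subgroup.closure (cs.simple '' J)

theorem wordProd_mem_parabolic {J : Set B} {ω : List B} (h : ∀ i ∈ ω, i ∈ J) :
    cs.wordProd ω ∈ cs.parabolic J := by
  apply Subgroup.list_prod_mem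
  intro x hx
  obtain ⟨i, hi, rfl⟩ := List.mem_map.mp hx
  exact Subgroup.subset_closure ⟨i, h i hi, rfl⟩

theorem exists_word_of_mem_parabolic {J : Set B} {w : W} (hw : w ∈ cs.parabolic J) :
    ∃ ω : List B, (∀ i ∈ ω, i ∈ J) ∧ w = cs.wordProd ω := by
  induction hw using Subgroup.closure_induction with
  | mem x hx =>
    obtain ⟨i, hi, rfl⟩ := hx
    exact ⟨[i], by simpa using hi, by simp⟩
  | one => exact ⟨[], by simp, by simp⟩
  | mul x y _ _ hx hy =>
    obtain ⟨a, ha, rfl⟩ := hx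
    obtain ⟨b, hb, rfl⟩ := hy
    refine ⟨a ++ b, fun i hi => ?_, by rw [wordProd_append]⟩
    rcases List.mem_append.mp hi with h | h
    exacts [ha i h, hb i h]
  | inv x _ hx =>
    obtain ⟨a, ha, rfl⟩ := hx
    exact ⟨a.reverse, fun i hi => ha i (List.mem_reverse.mp hi), by rw [wordProd_reverse]⟩

theorem exists_isReduced_of_mem_parabolic {J : Set B} {w : W} (hw : w ∈ cs.parabolic J) :
    ∃ ω : List B, (∀ i ∈ ω, i ∈ J) ∧ cs.IsReduced ω ∧ w = cs.wordProd ω := by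
  obtain ⟨ω, hω, rfl⟩ := cs.exists_word_of_mem_parabolic hw
  clear hw
  induction ω using List.reverseRecOn with
  | nil => exact ⟨[], by simp, by simp [IsReduced], rfl⟩
  | append_singleton υ i ih =>
    obtain ⟨ω, h1, h2, h3⟩ := ih fun j hj => hω j (by simp [hj])
    have hi : i ∈ J := hω i (by simp)
    have e : cs.wordProd (υ ++ [i]) = cs.wordProd ω * cs.simple i := by
      rw [wordProd_append, h3, wordProd_singleton]
    rcases cs.length_mul_simple (cs.wordProd ω) i with h | h
    · refine ⟨ω ++ [i], ?_, ?_, ?_⟩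
      · intro j hj
        rcases List.mem_append.mp hj with hj | hj
        · exact h1 j hj
        · rw [List.mem_singleton.mp hj]; exact hi
      · rw [IsReduced, wordProd_append, wordProd_singleton, h, h2.eq]; simp
      · rw [e, wordProd_append, wordProd_singleton]
    · obtain ⟨k, hk, hk2, -⟩ := cs.exists_eraseIdx_of_length_mul_le
        (cs.isReflection_simple i) ω (by omega)
      refine ⟨ω.eraseIdx k, fun j hj => h1 j (List.mem_of_mem_eraseIdx hj), ?_, by rw [e, hk2]⟩
      have := List.length_eraseIdx_add_one hk
      rw [IsReduced, ← hk2]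
      have := h2.eq
      omega

theorem eq_one_of_mem_parabolic {J K : Set B} (hJK : Disjoint J K) {w : W}
    (hJ : w ∈ cs.parabolic J) (hK : w ∈ cs.parabolic K) : w = 1 := by
  obtain ⟨ω, h1, h2, h3⟩ := cs.exists_isReduced_of_mem_parabolic hJ
  obtain ⟨υ, k1, k2, k3⟩ := cs.exists_isReduced_of_mem_parabolic hK
  rcases List.eq_nil_or_concat' ω with rfl | ⟨ω', i, rfl⟩
  · simpa using h3
  exfalso
  have hi : i ∈ J := h1 i (by simp)
  have hle : cs.length (w * cs.simple i) ≤ cs.length w := by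
    have : cs.length w = ω'.length + 1 := by rw [h3, h2.eq]; simp
    rw [this, h3, wordProd_append, wordProd_singleton, simple_mul_simple_cancel_right]
    exact (cs.length_wordProd_le _).trans (by omega)
  have hs : cs.simple i ∈ cs.parabolic K := by
    rw [k3] at hle
    obtain ⟨k, hk, hk2, -⟩ := cs.exists_eraseIdx_of_length_mul_le
      (cs.isReflection_simple i) υ hle
    have : cs.simple i = (cs.wordProd υ)⁻¹ * cs.wordProd (υ.eraseIdx k) := by
      rw [← hk2]; group
    rw [this]
    exact mul_mem (inv_mem (cs.wordProd_mem_parabolic k1))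
      (cs.wordProd_mem_parabolic fun j hj => k1 j (List.mem_of_mem_eraseIdx hj))
  obtain ⟨θ, t1, t2, t3⟩ := cs.exists_isReduced_of_mem_parabolic hs
  have hl : θ.length = 1 := by rw [← t2.eq, ← t3, length_simple]
  obtain ⟨j, rfl⟩ := List.length_eq_one_iff.mp hl
  rw [wordProd_singleton] at t3
  have : i = j := cs.simple_injective t3
  exact Set.disjoint_left.mp hJK hi (this ▸ t1 j (by simp))

/-- `w` is an element of maximal length in the standard parabolic subgroup `W_J`. -/
def IsLongest (J : Set B) (w : W) : Prop :=
  w ∈ cs.parabolic J ∧ ∀ v ∈ cs.parabolic J, cs.length v ≤ cs.length w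

theorem IsLongest.eq {cs : CoxeterSystem M W} {J : Set B} {v w : W} (hv : cs.IsLongest J v)
    (hw : cs.IsLongest J w) : v = w := by
  have hx : v⁻¹ * w ∈ cs.parabolic J := mul_mem (inv_mem hv.1) hw.1
  obtain ⟨ω, h1, h2, h3⟩ := cs.exists_isReduced_of_mem_parabolic hx
  rcases List.eq_nil_or_concat' ω with rfl | ⟨ω', i, rfl⟩
  · rw [wordProd_nil] at h3
    exact (inv_mul_eq_one.mp h3)
  exfalso
  have hs : cs.simple i ∈ cs.parabolic J := Subgroup.subset_closure ⟨i, h1 i (by simp), rfl⟩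
  have hr := cs.isReflection_simple i
  have key : ∀ {u : W}, cs.IsLongest J u → ∀ {t : W}, cs.IsReflection t → t ∈ cs.parabolic J →
      cs.invParity u t = 1 := by
    intro u hu t ht htJ
    have := cs.invParity_ne_zero_of_length_mul_le ht (hu.2 _ (mul_mem hu.1 htJ))
    revert this
    generalize cs.invParity u t = z
    revert z
    decide
  have e : w = v * (v⁻¹ * w) := by group
  have a1 := key hw hr hs
  have a2 := key hv (hr.conj (v⁻¹ * w)) (mul_mem (mul_mem hx hs) (inv_mem hx))
  rw [e, invParity_mul, a2] at a1
  have a3 : cs.invParity (v⁻¹ * w) (cs.simple i) = 0 := by simpa using a1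
  refine cs.invParity_ne_zero_of_length_mul_le hr ?_ a3
  have : cs.length (v⁻¹ * w) = ω'.length + 1 := by rw [h3, h2.eq]; simp
  rw [this, h3, wordProd_append, wordProd_singleton, simple_mul_simple_cancel_right]
  exact (cs.length_wordProd_le _).trans (by omega)

theorem IsLongest.inv {cs : CoxeterSystem M W} {J : Set B} {w : W} (hw : cs.IsLongest J w) :
    cs.IsLongest J w⁻¹ :=
  ⟨inv_mem hw.1, by simpa using hw.2⟩

theorem IsLongest.mul_self {cs : CoxeterSystem M W} {J : Set B} {w : W}
    (hw : cs.IsLongest J w) : w * w = 1 :=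
  mul_eq_one_iff_eq_inv.mpr (hw.eq hw.inv)

theorem existsUnique_isLongest {J : Set B} (hJ : Finite (cs.parabolic J)) :
    ∃! w, cs.IsLongest J w := by
  obtain ⟨w, hw⟩ := Finite.exists_max fun v : cs.parabolic J => cs.length (v : W)
  exact ⟨w, ⟨w.2, fun v hv => hw ⟨v, hv⟩⟩, fun v hv => hv.eq ⟨w.2, fun v hv => hw ⟨v, hv⟩⟩⟩

theorem IsLongest.ne {cs : CoxeterSystem M W} {J K : Set B} (hJK : Disjoint J K)
    (hJ : J.Nonempty) {v w : W} (hv : cs.IsLongest J v) (hw : cs.IsLongest K w) : v ≠ w := by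
  rintro rfl
  have h1 := cs.eq_one_of_mem_parabolic hJK hv.1 hw.1
  obtain ⟨i, hi⟩ := hJ
  have := hv.2 _ (Subgroup.subset_closure ⟨i, hi, rfl⟩)
  rw [h1, length_simple, length_one] at this
  omega

end Parabolic

end CoxeterSystem

namespace CoxeterMatrix

variable {I : Type*}

/-! ### Artin-Tits groups -/

/-- The alternating product `x y x y ⋯` of `n` terms, starting with `x`. -/
def altProd {G : Type*} [Monoid G] : ℕ → G → G → G
  | 0, _, _ => 1
  | n + 1, x, y => x * altProd n y x

/-- The braid relators of `M`. An infinite label is encoded by the entry `0`, as in Mathlib, and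
gives no relator. -/
def artinRelators (M : CoxeterMatrix I) : Set (FreeGroup I) :=
  {r | ∃ i j : I, M i j ≠ 0 ∧
    r = altProd (M i j) (FreeGroup.of i) (FreeGroup.of j) *
      (altProd (M i j) (FreeGroup.of j) (FreeGroup.of i))⁻¹}

/-- The Artin-Tits group `B_M`. -/
abbrev ArtinGroup (M : CoxeterMatrix I) : Type _ := PresentedGroup M.artinRelators

/-- The standard generators of the Artin-Tits group. -/
def artinGen (M : CoxeterMatrix I) (i : I) : M.ArtinGroup := PresentedGroup.of i

/-- A chosen reduced word of `w`. -/
def reducedWord (M : CoxeterMatrix I) (w : M.Group) : List I :=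
  (M.toCoxeterSystem.exists_isReduced w).choose

/-- The section `W_M → B_M` of the canonical projection: the image of `w` is represented by a
reduced word of `w`. (Any two reduced words of `w` differ by braid moves, so the choice of the
reduced word is irrelevant.) -/
def simpleElement (M : CoxeterMatrix I) (w : M.Group) : M.ArtinGroup :=
  ((M.reducedWord w).map M.artinGen).prod

/-- A Coxeter matrix is spherical if its Coxeter group is finite. -/
def IsSpherical (M : CoxeterMatrix I) : Prop := Finite M.Group

/-! ### Admissible partitions -/

/-- `I⁺(w)` -/
def ascentSet (M : CoxeterMatrix I) (w : M.Group) : Set I :=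
  {i | M.toCoxeterSystem.length (w * M.simple i) = M.toCoxeterSystem.length w + 1}

/-- `I⁻(w)` -/
def descentSet (M : CoxeterMatrix I) (w : M.Group) : Set I :=
  {i | M.toCoxeterSystem.length (w * M.simple i) + 1 = M.toCoxeterSystem.length w}

/-- A spherical partition of a Coxeter matrix: a partition of the index set (into non-empty
blocks) such that the standard parabolic subgroup of each block is finite. -/
structure SphericalPartition (M : CoxeterMatrix I) where
  blocks : Set (Set I)
  isPartition : Setoid.IsPartition blocks
  finite_parabolic : ∀ α ∈ blocks, Finite (M.toCoxeterSystem.parabolic α)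

namespace SphericalPartition

variable {M : CoxeterMatrix I} (P : SphericalPartition M)

/-- `r_α`, the unique element of maximal length in the finite standard parabolic subgroup
`W_α`. -/
def longest (α : P.blocks) : M.Group :=
  (M.toCoxeterSystem.existsUnique_isLongest (P.finite_parabolic α α.2)).choose

theorem isLongest_longest (α : P.blocks) :
    M.toCoxeterSystem.IsLongest (α : Set I) (P.longest α) :=
  (M.toCoxeterSystem.existsUnique_isLongest (P.finite_parabolic α α.2)).choose_spec.1

theorem longest_injective : Function.Injective P.longest := by
  intro α β h
  by_contra hne
  have hne' : (α : Set I) ≠ β := fun h => hne (Subtype.ext h)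
  have hd : Disjoint (α : Set I) β := P.isPartition.pairwiseDisjoint α.2 β.2 hne'
  exact (P.isLongest_longest α).ne hd (Setoid.nonempty_of_mem_partition P.isPartition α.2)
    (P.isLongest_longest β) h

theorem longest_mul_self (α : P.blocks) : P.longest α * P.longest α = 1 :=
  (P.isLongest_longest α).mul_self

/-- The type of `P`: the Coxeter matrix, indexed by the blocks, of the orders of the products
`r_α r_β` (the value `0` of `orderOf` encodes an infinite order). -/
def type : CoxeterMatrix P.blocks where
  M := Matrix.of fun α β => orderOf (P.longest α * P.longest β)
  isSymm := by
    ext α β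
    have h : ∀ γ, (P.longest γ)⁻¹ = P.longest γ := fun γ =>
      inv_eq_of_mul_eq_one_left (P.longest_mul_self γ)
    show orderOf (P.longest β * P.longest α) = orderOf (P.longest α * P.longest β)
    rw [← orderOf_inv, mul_inv_rev, h, h]
  diagonal α := by simp [longest_mul_self]
  off_diagonal α β hαβ h := by
    rw [Matrix.of_apply, orderOf_eq_one_iff, mul_eq_one_iff_eq_inv] at h
    exact hαβ (P.longest_injective (h.trans
      (inv_eq_of_mul_eq_one_left (P.longest_mul_self β))))

/-- The subgroup of the Coxeter group generated by the `r_α`. -/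
def coxeterSubgroup : Subgroup M.Group := Subgroup.closure (Set.range P.longest)

/-- Admissibility: for all `w` in the subgroup generated by the `r_α` and every block `α`, either
`α ⊆ I⁺(w)` or `α ⊆ I⁻(w)`. -/
def IsAdmissible : Prop :=
  ∀ w ∈ P.coxeterSubgroup, ∀ α ∈ P.blocks, α ⊆ M.ascentSet w ∨ α ⊆ M.descentSet w

/-- The image of `r_α` in the Artin-Tits group. -/
def artinLongest (α : P.blocks) : M.ArtinGroup := M.simpleElement (P.longest α)

/-- The subgroup of the Artin-Tits group generated by the images of the `r_α`. -/
def artinSubgroup : Subgroup M.ArtinGroup := Subgroup.closure (Set.range P.artinLongest)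

end SphericalPartition

end CoxeterMatrix

end

/-!
The proof compares greedy normal forms in the two Artin-Tits groups.

Let `W` be the Coxeter group of `Γ` and `W'` its subgroup generated by the longest elements `r_α`
of the blocks. Admissibility makes `W'` behave like a Coxeter group with generators `r_α` whose
length is the restriction of the length `ℓ` of `W`: multiplication by `r_α` changes `ℓ` by exactly
`± ℓ(r_α)`, and the exchange condition holds (`IsAdmissible.exchange`). Both `W` and `W'` are
therefore instances of `IsExchangeLength`, a group generated by involutions with a weighted length
function, and the theory is developed once for that notion. In it, Matsumoto's theorem
(`prod_map_eq_of_isRed`) shows that a family satisfying the braid relations, whose exponents are the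
orders of the products of two generators, extends to a map that is multiplicative on
length-additive products (`exists_lengthAdditive`). For `W` one needs that `s_i s_j` has order
`m_{i,j}` (`orderOf_simple_mul_simple`), which is read off the geometric representation. This gives
the sections of `W` and of `W'` in the two Artin-Tits groups, and the homomorphism `φ`, which
intertwines them (`IsAdmissible.exists_hom`). The Coxeter group of the type enters only through its
surjection onto `W'`, which is thus finite.

Since `W'` is finite, it has an element `D` of maximal length. It has every simple reflection of `W`
as a descent, hence every `w ∈ W` can be split off from it (`length_mul_of_descents`,
`IsAdmissible.exists_longest`), and the square of the image of `D` is central in both Artin-Tits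
groups.

Given `v, w ∈ W` there is a greatest prefix of `w` that `v` can absorb with additive lengths
(`exists_greatest`). Absorbing again and again turns `v` into a transformation `act v` of the
sequences `ℕ → W`, and `act (v * u) = act v ∘ act u` when the lengths add up (`act_mul`). On the
direct limit along `act D ∘ act D` these transformations become invertible, so the Artin-Tits group
of `Γ` acts there (`exists_perm_action`). A product of simple elements `w₁, …, wₘ` in which no
factor can absorb anything from the next one sends the constant sequence `1` to
`w₁, …, wₘ, 1, 1, …`; hence the group element determines such a sequence
(`prod_simpleElement_injOn`).

Finally, let `b` be in the kernel of `φ`. A power of the central element times `b` is positive, and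
can be written as a greedy product of elements of `W'` (`LengthAdditive.exists_greedy`). By
admissibility such a product is still greedy in `W` (`IsAdmissible.absorb_eq_one`). Its image under
`φ` is a power of the lift of `D`, so it agrees with `D, …, D` term by term, and `b = 1`.
-/

/-! ### Groups generated by involutions with an exchange length -/

/-- A weighted length function on a group `G` generated by involutions `r a`: right multiplication
by `r a` changes the length by exactly `L (r a)`, and the exchange condition holds. The Coxeter
length is an example with all weights `1`; the weights make room for the subgroup generated by the
longest elements of the blocks of an admissible partition, with the length of the ambient Coxeter
group. -/
structure IsExchangeLength {A G : Type*} [Group G] (r : A → G) (L : G → ℕ) : Prop where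
  one : L 1 = 0
  inv : ∀ g, L g⁻¹ = L g
  mul_self : ∀ a, r a * r a = 1
  pos : ∀ a, 0 < L (r a)
  inj : Function.Injective r
  step : ∀ g a, L (g * r a) = L g + L (r a) ∨ L g = L (g * r a) + L (r a)
  exchange : ∀ u a b, L u < L (u * r b) → L (r a * u * r b) < L (r a * u) → r a * u = u * r b
  closure : Subgroup.closure (Set.range r) = ⊤

namespace IsExchangeLength

open CoxeterSystem (alternatingWord alternatingWord_succ alternatingWord_succ')
open CoxeterMatrix (altProd)

variable {A G : Type*} [Group G] {r : A → G} {L : G → ℕ}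

/-- The product in `G` of a word in the generators. -/
def eval (r : A → G) (ω : List A) : G := (ω.map r).prod

/-- The sum of the lengths of the letters of a word. -/
def weight (r : A → G) (L : G → ℕ) (ω : List A) : ℕ := (ω.map fun a => L (r a)).sum

@[simp] theorem eval_nil : eval r [] = 1 := rfl
@[simp] theorem eval_cons (a : A) (ω : List A) : eval r (a :: ω) = r a * eval r ω := by simp [eval]
@[simp] theorem eval_append (ω υ : List A) : eval r (ω ++ υ) = eval r ω * eval r υ := by simp [eval]
omit [Group G] in
@[simp] theorem weight_nil : weight r L [] = 0 := rfl
omit [Group G] in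
@[simp] theorem weight_cons (a : A) (ω : List A) :
    weight r L (a :: ω) = L (r a) + weight r L ω := by simp [weight]
omit [Group G] in
@[simp] theorem weight_append (ω υ : List A) :
    weight r L (ω ++ υ) = weight r L ω + weight r L υ := by simp [weight]

/-- A word is reduced if the weights of its letters add up to the length of its product. -/
def IsRed (r : A → G) (L : G → ℕ) (ω : List A) : Prop := L (eval r ω) = weight r L ω

theorem eval_mem {J : Set A} {ω : List A} (h : ∀ a ∈ ω, a ∈ J) :
    eval r ω ∈ Subgroup.closure (r '' J) := by
  apply Subgroup.list_prod_mem
  intro x hx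
  obtain ⟨i, hi, rfl⟩ := List.mem_map.mp hx
  exact Subgroup.subset_closure ⟨i, h i hi, rfl⟩

variable (h : IsExchangeLength r L)
include h

theorem inv_r (a : A) : (r a)⁻¹ = r a := inv_eq_of_mul_eq_one_left (h.mul_self a)

theorem mul_cancel (g : G) (a : A) : g * r a * r a = g := by
  rw [mul_assoc, h.mul_self, mul_one]

theorem cancel_mul (g : G) (a : A) : r a * (r a * g) = g := by
  rw [← mul_assoc, h.mul_self, one_mul]

theorem length_mul_eq {g : G} {a : A} (hg : L g < L (g * r a)) :
    L (g * r a) = L g + L (r a) := by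
  have := h.step g a
  omega

theorem length_eq_of_lt {g : G} {a : A} (hg : L (g * r a) < L g) :
    L g = L (g * r a) + L (r a) := by
  have := h.step g a
  omega

theorem lt_or_gt (g : G) (a : A) : L g < L (g * r a) ∨ L (g * r a) < L g := by
  have := h.step g a
  have := h.pos a
  omega

theorem length_r_mul (g : G) (a : A) : L (r a * g) = L (g⁻¹ * r a) := by
  rw [← h.inv, mul_inv_rev, h.inv_r]

theorem length_mul_eval_le (g : G) (ω : List A) : L (g * eval r ω) ≤ L g + weight r L ω := by
  induction ω generalizing g with
  | nil => simp
  | cons a ω ih =>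
    rw [eval_cons, ← mul_assoc, weight_cons]
    have h1 := ih (g * r a)
    have h2 := h.step g a
    omega

theorem length_eval_le (ω : List A) : L (eval r ω) ≤ weight r L ω := by
  have := h.length_mul_eval_le 1 ω
  rwa [one_mul, h.one, zero_add] at this

/-- The exchange property: the deleted letter is found to the left of `u`. -/
theorem exchange_word {u : G} {b : A} (hu : L u < L (u * r b)) (η : List A)
    (hη : L (eval r η * u * r b) < L (eval r η * u)) :
    ∃ η' : List A, (∀ a ∈ η', a ∈ η) ∧ weight r L η' + L (r b) = weight r L η ∧
      eval r η * u * r b = eval r η' * u := by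
  induction η with
  | nil => simp only [eval_nil, one_mul] at hη; omega
  | cons c η ih =>
    rcases h.lt_or_gt (eval r η * u) b with h1 | h1
    · have h2 := h.exchange (eval r η * u) c b h1
        (by simpa only [eval_cons, mul_assoc] using hη)
      refine ⟨η, fun a ha => by simp [ha], ?_, ?_⟩
      · have e1 := h.length_mul_eq h1
        have e2 : L (r c * (eval r η * u)) = L (eval r η * u) + L (r c) ∨
            L (eval r η * u) = L (r c * (eval r η * u)) + L (r c) := by
          rw [h.length_r_mul, ← h.inv (eval r η * u)]
          exact h.step _ _
        rw [h2] at e2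
        have := h.pos b
        rw [weight_cons]
        omega
      · rw [eval_cons, mul_assoc (r c), mul_assoc (r c), ← h2, ← mul_assoc, h.mul_self, one_mul]
    · obtain ⟨η', k1, k2, k3⟩ := ih h1
      refine ⟨c :: η', ?_, ?_, ?_⟩
      · intro a ha
        rcases List.mem_cons.mp ha with rfl | ha
        · simp
        · simp [k1 a ha]
      · simp only [weight_cons]; omega
      · simp only [eval_cons, mul_assoc] at k3 ⊢
        rw [k3]

theorem exists_isRed {J : Set A} {g : G} (hg : g ∈ Subgroup.closure (r '' J)) :
    ∃ ω : List A, (∀ a ∈ ω, a ∈ J) ∧ IsRed r L ω ∧ eval r ω = g := by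
  have key : ∀ g a, a ∈ J → (∃ ω : List A, (∀ a ∈ ω, a ∈ J) ∧ IsRed r L ω ∧ eval r ω = g) →
      ∃ ω : List A, (∀ a ∈ ω, a ∈ J) ∧ IsRed r L ω ∧ eval r ω = g * r a := by
    rintro g a ha ⟨ω, h1, h2, rfl⟩
    rw [IsRed] at h2
    rcases h.lt_or_gt (eval r ω) a with h3 | h3
    · refine ⟨ω ++ [a], ?_, ?_, by simp⟩
      · intro b hb
        rcases List.mem_append.mp hb with hb | hb
        · exact h1 b hb
        · rw [List.mem_singleton.mp hb]; exact ha
      · have := h.length_mul_eq h3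
        simp only [IsRed, eval_append, eval_cons, eval_nil, mul_one, weight_append, weight_cons,
          weight_nil]
        omega
    · obtain ⟨ω', k1, k2, k3⟩ := h.exchange_word (u := 1) (b := a)
        (by rw [h.one, one_mul]; exact h.pos a) ω (by simpa using h3)
      rw [mul_one, mul_one] at k3
      refine ⟨ω', fun b hb => h1 b (k1 b hb), ?_, k3.symm⟩
      have := h.length_eq_of_lt h3
      rw [IsRed, ← k3]
      omega
  induction hg using Subgroup.closure_induction_right with
  | one => exact ⟨[], by simp, by simp [IsRed, h.one], rfl⟩
  | mul_right x hx y hy ih =>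
    obtain ⟨a, ha, rfl⟩ := hy
    exact key x a ha ih
  | mul_inv_cancel x hx y hy ih =>
    obtain ⟨a, ha, rfl⟩ := hy
    rw [h.inv_r]
    exact key x a ha ih

theorem exists_isRed_univ (g : G) : ∃ ω : List A, IsRed r L ω ∧ eval r ω = g := by
  obtain ⟨ω, -, h1, h2⟩ := h.exists_isRed (J := Set.univ) (g := g)
    (by rw [Set.image_univ, h.closure]; trivial)
  exact ⟨ω, h1, h2⟩

theorem length_mul_le (g k : G) : L (g * k) ≤ L g + L k := by
  obtain ⟨ω, h1, rfl⟩ := h.exists_isRed_univ k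
  rw [h1]
  exact h.length_mul_eval_le g ω

theorem isRed_append {ω υ : List A} (hr : IsRed r L (ω ++ υ)) :
    IsRed r L ω ∧ IsRed r L υ ∧ L (eval r ω * eval r υ) = L (eval r ω) + L (eval r υ) := by
  have h1 := h.length_eval_le ω
  have h2 := h.length_eval_le υ
  have h3 := h.length_mul_le (eval r ω) (eval r υ)
  rw [IsRed, eval_append, weight_append] at hr
  simp only [IsRed]
  omega

theorem eq_one_of_length {g : G} (hg : L g = 0) : g = 1 := by
  obtain ⟨ω, h1, rfl⟩ := h.exists_isRed_univ g
  cases ω with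
  | nil => rfl
  | cons a ω =>
    rw [h1, weight_cons] at hg
    have := h.pos a
    omega

/-- A nontrivial element of a standard parabolic subgroup has a descent there. -/
theorem exists_descent {J : Set A} {g : G} (hg : g ∈ Subgroup.closure (r '' J)) (h1 : g ≠ 1) :
    ∃ a ∈ J, L (g * r a) < L g := by
  obtain ⟨ω, k1, k2, rfl⟩ := h.exists_isRed hg
  rcases List.eq_nil_or_concat' ω with rfl | ⟨ω', a, rfl⟩
  · exact absurd rfl h1
  refine ⟨a, k1 a (by simp), ?_⟩
  have h2 := (h.isRed_append k2).1
  rw [IsRed] at h2 k2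
  rw [k2]
  simp only [eval_append, eval_cons, eval_nil, mul_one, h.mul_cancel, weight_append, weight_cons,
    weight_nil]
  have := h.pos a
  omega

/-! ### Cosets of standard parabolic subgroups -/

theorem length_mul_of_minimal {J : Set A} {g : G}
    (hg : ∀ y ∈ Subgroup.closure (r '' J), L g ≤ L (g * y)) {ω : List A}
    (hω : ∀ a ∈ ω, a ∈ J) (hr : IsRed r L ω) : L (g * eval r ω) = L g + weight r L ω := by
  induction ω using List.reverseRecOn with
  | nil => simp
  | append_singleton ω b ih =>
    obtain ⟨r1, r2, r3⟩ := h.isRed_append hr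
    have e := ih (fun a ha => hω a (by simp [ha])) r1
    have hb : b ∈ J := hω b (by simp)
    rw [eval_cons, eval_nil, mul_one] at r3
    rcases h.lt_or_gt (g * eval r ω) b with h1 | h1
    · have := h.length_mul_eq h1
      simp only [eval_append, eval_cons, eval_nil, mul_one, weight_append, weight_cons, weight_nil,
        ← mul_assoc]
      omega
    · exfalso
      obtain ⟨η, k1, rfl⟩ := h.exists_isRed_univ g
      have := h.pos b
      obtain ⟨η', -, m2, m3⟩ := h.exchange_word (u := eval r ω) (b := b) (by omega) η h1
      have hm : eval r ω * r b * (eval r ω)⁻¹ ∈ Subgroup.closure (r '' J) :=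
        mul_mem (mul_mem (eval_mem fun a ha => hω a (by simp [ha]))
          (Subgroup.subset_closure ⟨b, hb, rfl⟩))
          (inv_mem (eval_mem fun a ha => hω a (by simp [ha])))
      have h2 := hg _ hm
      have h3 : eval r η * (eval r ω * r b * (eval r ω)⁻¹) = eval r η' := by
        rw [← mul_assoc, ← mul_assoc, m3]; group
      rw [h3, k1] at h2
      have := h.length_eval_le η'
      omega

/-- Every coset of a standard parabolic subgroup has a representative with additive lengths. -/
theorem exists_coset_factorization (J : Set A) (g : G) :
    ∃ x, ∃ y ∈ Subgroup.closure (r '' J), g = x * y ∧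
      ∀ z ∈ Subgroup.closure (r '' J), L (x * z) = L x + L z := by
  classical
  have hne : ∃ n, ∃ y ∈ Subgroup.closure (r '' J), L (g * y) = n := ⟨_, 1, one_mem _, rfl⟩
  obtain ⟨y, hy, hn⟩ := Nat.find_spec hne
  refine ⟨g * y, y⁻¹, inv_mem hy, by group, fun z hz => ?_⟩
  obtain ⟨ω, k1, k2, rfl⟩ := h.exists_isRed hz
  rw [k2]
  refine h.length_mul_of_minimal (fun z hz => ?_) k1 k2
  rw [hn]
  exact Nat.find_min' hne ⟨y * z, mul_mem hy hz, by rw [mul_assoc]⟩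

theorem length_mul_of_ascents {J : Set A} {g : G} (hg : ∀ a ∈ J, L g < L (g * r a)) {z : G}
    (hz : z ∈ Subgroup.closure (r '' J)) : L (g * z) = L g + L z := by
  obtain ⟨x, y, hy, rfl, hx⟩ := h.exists_coset_factorization J g
  suffices y = 1 by
    subst this
    rw [mul_one]
    exact hx z hz
  by_contra hne
  obtain ⟨a, ha, h1⟩ := h.exists_descent hy hne
  have h2 := hg a ha
  rw [mul_assoc, hx _ hy, hx _ (mul_mem hy (Subgroup.subset_closure ⟨a, ha, rfl⟩))] at h2
  omega

/-! ### Dihedral subgroups -/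

omit h in
theorem prod_map_alternatingWord {N : Type*} [Monoid N] (f : A → N) (a b : A) (k : ℕ) :
    ((alternatingWord a b k).map f).prod =
      if Even k then altProd k (f a) (f b) else altProd k (f b) (f a) := by
  induction k with
  | zero => simp [alternatingWord, altProd]
  | succ k ih =>
    rw [alternatingWord_succ', List.map_cons, List.prod_cons, ih]
    by_cases hk : Even k <;> simp [hk, Nat.even_add_one, altProd]

omit h in
theorem prod_map_alternatingWord_comm {N : Type*} [Monoid N] (f : A → N) (a b : A) (k : ℕ) :
    ((alternatingWord a b k).map f).prod = ((alternatingWord b a k).map f).prod ↔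
      altProd k (f a) (f b) = altProd k (f b) (f a) := by
  rw [prod_map_alternatingWord, prod_map_alternatingWord]
  split_ifs
  · rfl
  · exact eq_comm

omit h in
theorem eval_alternatingWord_succ (a b : A) (k : ℕ) :
    eval r (alternatingWord a b (k + 1)) = eval r (alternatingWord b a k) * r b := by
  simp [alternatingWord_succ]

omit [Group G] h in
theorem weight_alternatingWord_succ (a b : A) (k : ℕ) :
    weight r L (alternatingWord a b (k + 1)) = weight r L (alternatingWord b a k) + L (r b) := by
  simp [alternatingWord_succ]

theorem eval_alternatingWord_eq_mul_pow (a b : A) (k : ℕ) :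
    eval r (alternatingWord b a k) = eval r (alternatingWord a b k) * (r b * r a) ^ k := by
  induction k with
  | zero => simp [alternatingWord]
  | succ k ih =>
    rw [eval_alternatingWord_succ, eval_alternatingWord_succ, ih]
    have key : ∀ n : ℕ, (r b * r a) ^ n * r b * (r b * r a) ^ n = r b := by
      intro n
      induction n with
      | zero => simp
      | succ n ihn =>
        calc (r b * r a) ^ (n + 1) * r b * (r b * r a) ^ (n + 1)
            = r b * r a * ((r b * r a) ^ n * r b * (r b * r a) ^ n) * (r b * r a) := by
              nth_rewrite 1 [pow_succ']
              rw [pow_succ]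
              simp only [mul_assoc]
          _ = r b := by
              rw [ihn, mul_assoc (r b * r a), h.cancel_mul, h.mul_cancel]
    calc eval r (alternatingWord a b k) * r a
        = eval r (alternatingWord a b k) *
            ((r b * r a) ^ k * r b * (r b * r a) ^ k * (r b * r a)) := by
          rw [key, h.cancel_mul]
      _ = eval r (alternatingWord a b k) * (r b * r a) ^ k * r b * (r b * r a) ^ (k + 1) := by
          rw [pow_succ]
          simp only [mul_assoc]

theorem eval_alternatingWord_comm (a b : A) (k : ℕ) :
    eval r (alternatingWord a b k) = eval r (alternatingWord b a k) ↔ (r a * r b) ^ k = 1 := by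
  rw [h.eval_alternatingWord_eq_mul_pow b a k]
  exact mul_eq_left

theorem pow_comm_eq_one (a b : A) (k : ℕ) : (r a * r b) ^ k = 1 ↔ (r b * r a) ^ k = 1 := by
  rw [← h.eval_alternatingWord_comm, ← h.eval_alternatingWord_comm, eq_comm]

theorem pow_ne_one_of_isRed {a b : A} {k : ℕ} (hr : IsRed r L (alternatingWord a b k)) {j : ℕ}
    (h0 : 0 < j) (hj : j < k) : (r a * r b) ^ j ≠ 1 := by
  induction k generalizing a b with
  | zero => omega
  | succ k ih =>
    intro ht
    have hr' := hr
    rw [alternatingWord_succ, List.concat_eq_append] at hr'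
    rcases Nat.lt_succ_iff_lt_or_eq.mp hj with hj | rfl
    · exact ih (h.isRed_append hr').1 hj ((h.pow_comm_eq_one a b j).mp ht)
    · obtain ⟨n, rfl⟩ : ∃ n, j = n + 1 := ⟨j - 1, by omega⟩
      have e : eval r (alternatingWord a b (n + 1 + 1)) = eval r (alternatingWord b a n) := by
        rw [eval_alternatingWord_succ, ← (h.eval_alternatingWord_comm a b _).mpr ht,
          eval_alternatingWord_succ, h.mul_cancel]
      rw [IsRed, e, alternatingWord_succ', weight_cons, weight_alternatingWord_succ] at hr
      have := h.length_eval_le (alternatingWord b a n)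
      have := h.pos b
      omega

theorem exists_pow_eq_one_of_descent {a b : A} {k : ℕ}
    (hd : L (eval r (alternatingWord a b k) * r a) < L (eval r (alternatingWord a b k))) :
    ∃ j, 0 < j ∧ j ≤ k ∧ (r a * r b) ^ j = 1 := by
  induction k with
  | zero => simp [alternatingWord, h.one] at hd
  | succ k ih =>
    rcases h.lt_or_gt (eval r (alternatingWord a b k)) a with h1 | h1
    · refine ⟨k + 1, by omega, le_rfl, ?_⟩
      rw [alternatingWord_succ', eval_cons] at hd
      have := h.exchange _ _ _ h1 hd
      rw [← h.eval_alternatingWord_comm, alternatingWord_succ' a b, eval_cons, this,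
        eval_alternatingWord_succ]
    · obtain ⟨j, j1, j2, j3⟩ := ih h1
      exact ⟨j, j1, by omega, j3⟩

theorem isRed_alternatingWord {a b : A} {k : ℕ}
    (hk : ∀ j, 0 < j → j < k → (r a * r b) ^ j ≠ 1) : IsRed r L (alternatingWord a b k) := by
  induction k generalizing a b with
  | zero => simp [IsRed, alternatingWord, h.one]
  | succ k ih =>
    have h1 := ih (a := b) (b := a)
      fun j j0 j1 j2 => hk j j0 (by omega) ((h.pow_comm_eq_one a b j).mpr j2)
    rw [IsRed] at h1
    rcases h.lt_or_gt (eval r (alternatingWord b a k)) b with h2 | h2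
    · rw [IsRed, eval_alternatingWord_succ, weight_alternatingWord_succ, h.length_mul_eq h2, h1]
    · obtain ⟨j, j1, j2, j3⟩ := h.exists_pow_eq_one_of_descent h2
      exact absurd ((h.pow_comm_eq_one a b j).mpr j3) (hk j j1 (by omega))

theorem isRed_alternatingWord_orderOf (a b : A) :
    IsRed r L (alternatingWord a b (orderOf (r a * r b))) :=
  h.isRed_alternatingWord fun j j0 j1 j2 => by
    have := Nat.le_of_dvd j0 (orderOf_dvd_of_pow_eq_one j2)
    omega

theorem eq_alternatingWord_of_isRed {a b : A} {ω : List A} (hω : ∀ c ∈ ω, c ∈ ({a, b} : Set A))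
    (hr : IsRed r L ω) : ∃ k, ω = alternatingWord a b k ∨ ω = alternatingWord b a k := by
  induction ω using List.reverseRecOn with
  | nil => exact ⟨0, by simp [alternatingWord]⟩
  | append_singleton ω c ih =>
    have hc : c = a ∨ c = b := hω c (by simp)
    obtain ⟨r1, r2, r3⟩ := h.isRed_append hr
    rw [eval_cons, eval_nil, mul_one] at r3
    obtain ⟨k, hk⟩ := ih (fun d hd => hω d (by simp [hd])) r1
    have key : ∀ x y n, ω = alternatingWord x y (n + 1) → c ≠ y := by
      rintro x y n rfl rfl
      rw [eval_alternatingWord_succ, h.mul_cancel] at r3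
      rw [IsRed, eval_alternatingWord_succ, weight_alternatingWord_succ] at r1
      have := h.length_eval_le (alternatingWord c x n)
      have := h.pos c
      omega
    rcases k with _ | k
    · have : ω = [] := by simpa [alternatingWord] using hk
      subst this
      refine ⟨1, ?_⟩
      rcases hc with rfl | rfl
      · right; simp [alternatingWord]
      · left; simp [alternatingWord]
    · refine ⟨k + 1 + 1, ?_⟩
      rcases hk with hk | hk
      · have hca : c = a := hc.resolve_right (key _ _ _ hk)
        right
        rw [hk, alternatingWord_succ b a, hca, List.concat_eq_append]
      · have hcb : c = b := hc.resolve_left (key _ _ _ hk)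
        left
        rw [hk, alternatingWord_succ a b, hcb, List.concat_eq_append]

/-- The element of a dihedral standard parabolic subgroup with both descents. -/
theorem eq_alternatingWord_of_descents {a b : A} {y : G}
    (hy : y ∈ Subgroup.closure (r '' {a, b})) (ha : L (y * r a) < L y) (hb : L (y * r b) < L y) :
    orderOf (r a * r b) ≠ 0 ∧ y = eval r (alternatingWord a b (orderOf (r a * r b))) := by
  have key : ∀ a b k, L (y * r a) < L y → IsRed r L (alternatingWord a b k) →
      eval r (alternatingWord a b k) = y → k ≠ 0 ∧ orderOf (r a * r b) = k := by
    rintro a b k ha hr rfl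
    obtain ⟨j, j0, j1, j2⟩ := h.exists_pow_eq_one_of_descent ha
    have h1 : orderOf (r a * r b) ≤ j := Nat.le_of_dvd j0 (orderOf_dvd_of_pow_eq_one j2)
    have h2 : 0 < orderOf (r a * r b) := orderOf_pos_iff.mpr
      (isOfFinOrder_iff_pow_eq_one.mpr ⟨j, j0, j2⟩)
    have h3 : ¬ orderOf (r a * r b) < k := fun hlt =>
      h.pow_ne_one_of_isRed hr h2 hlt (pow_orderOf_eq_one _)
    omega
  obtain ⟨ω, k1, k2, k3⟩ := h.exists_isRed hy
  obtain ⟨k, rfl | rfl⟩ := h.eq_alternatingWord_of_isRed k1 k2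
  · obtain ⟨k0, rfl⟩ := key _ _ _ ha k2 k3
    exact ⟨k0, k3.symm⟩
  · obtain ⟨k0, hk⟩ := key _ _ _ hb k2 k3
    have e : orderOf (r a * r b) = orderOf (r b * r a) := by
      rw [← orderOf_inv, mul_inv_rev, h.inv_r, h.inv_r]
    refine ⟨by omega, ?_⟩
    rw [(h.eval_alternatingWord_comm _ _ _).mpr (pow_orderOf_eq_one _), e, hk, k3]

theorem exists_dihedral_factorization {a b : A} {g : G} (ha : L (g * r a) < L g)
    (hb : L (g * r b) < L g) : ∃ x, ∃ y ∈ Subgroup.closure (r '' {a, b}), g = x * y ∧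
      L g = L x + L y ∧ L (y * r a) < L y ∧ L (y * r b) < L y := by
  obtain ⟨x, y, hy, rfl, hx⟩ := h.exists_coset_factorization {a, b} g
  refine ⟨x, y, hy, rfl, hx y hy, ?_, ?_⟩
  · rw [mul_assoc, hx _ hy, hx _ (mul_mem hy (Subgroup.subset_closure ⟨a, by simp, rfl⟩))] at ha
    omega
  · rw [mul_assoc, hx _ hy, hx _ (mul_mem hy (Subgroup.subset_closure ⟨b, by simp, rfl⟩))] at hb
    omega

theorem length_mul_dihedral {a b : A} {g : G} (ha : L (g * r a) < L g)
    (hb : L (g * r b) < L g) {y : G} (hy : y ∈ Subgroup.closure (r '' {a, b})) :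
    L (g * y) + L y = L g := by
  have key : ∀ (a b : A) (k : ℕ), L (g * r a) < L g → L (g * r b) < L g →
      IsRed r L (alternatingWord a b k) →
      L (g * (eval r (alternatingWord a b k))⁻¹) + weight r L (alternatingWord a b k) = L g := by
    intro a b k ha hb
    induction k with
    | zero => intro; simp [alternatingWord]
    | succ k ih =>
      intro hr
      have hr' := hr
      rw [alternatingWord_succ', ← List.singleton_append] at hr'
      have e1 := ih (h.isRed_append hr').2.1
      rw [alternatingWord_succ', eval_cons, weight_cons, mul_inv_rev, h.inv_r, ← mul_assoc]
      set c := if Even k then b else a with hc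
      set gk := g * (eval r (alternatingWord a b k))⁻¹ with hgk
      rcases h.lt_or_gt gk c with h1 | h1
      · exfalso
        rcases k with _ | k
        · simp [hc, hgk, alternatingWord] at h1
          omega
        · have e2 := ih (h.isRed_append hr').2.1
          -- `gk` was reached by a descent along `c'`, so it has an ascent at `c'` too and is
          -- minimal in its coset; then the alternating word of length `k + 1` has both descents of
          -- `g`, although its one-letter extension is reduced
          set c' := if Even k then b else a with hc'
          have e3 : gk * r c' = g * (eval r (alternatingWord a b k))⁻¹ := by
            rw [hgk, alternatingWord_succ', eval_cons, mul_inv_rev, h.inv_r, ← mul_assoc,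
              h.mul_cancel]
          have h2 : L gk < L (gk * r c') := by
            have h5 := h.step gk c'
            have h6 := h.pos c'
            have h7 := h.length_mul_le (gk * r c') (eval r (alternatingWord a b k))
            rw [e3, inv_mul_cancel_right, ← e3] at h7
            have h8 := h.length_eval_le (alternatingWord a b k)
            rw [alternatingWord_succ', weight_cons] at e2
            omega
          have hJ : ∀ d ∈ ({a, b} : Set A), L gk < L (gk * r d) := by
            rintro d (rfl | rfl) <;> by_cases hk : Even k <;>
              simp_all [Nat.even_add_one]
          have hm : eval r (alternatingWord a b (k + 1)) ∈ Subgroup.closure (r '' {a, b}) := by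
            refine eval_mem fun d hd => ?_
            clear * - hd
            generalize k + 1 = n at hd
            induction n with
            | zero => simp [alternatingWord] at hd
            | succ n ihn =>
              rw [alternatingWord_succ'] at hd
              rcases List.mem_cons.mp hd with hd | hd
              · rw [hd]; split_ifs <;> simp
              · exact ihn hd
          have h3 := h.length_mul_of_ascents hJ hm
          have h4 := h.length_mul_of_ascents hJ
            (mul_mem hm (Subgroup.subset_closure ⟨a, by simp, rfl⟩))
          have e4 : gk * eval r (alternatingWord a b (k + 1)) = g := by rw [hgk]; group
          rw [← mul_assoc, e4] at h4
          rw [e4] at h3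
          obtain ⟨j, j0, j1, j2⟩ := h.exists_pow_eq_one_of_descent
            (a := a) (b := b) (k := k + 1) (by omega)
          exact h.pow_ne_one_of_isRed hr j0 (by omega) j2
      · have := h.length_eq_of_lt h1
        omega
  obtain ⟨ω, k1, k2, k3⟩ := h.exists_isRed (inv_mem hy)
  obtain ⟨k, hk⟩ := h.eq_alternatingWord_of_isRed k1 k2
  have e : L y = weight r L ω := by rw [← h.inv, ← k3, k2]
  have e' : y = (eval r ω)⁻¹ := by rw [k3, inv_inv]
  rw [e, e']
  rcases hk with rfl | rfl
  · exact key a b k ha hb k2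
  · exact key b a k hb ha k2

/-- If every `a ∈ J` is a descent of `g`, every element of the standard parabolic subgroup of `J`
can be split off from `g` on the right. -/
theorem length_mul_of_descents {J : Set A} {g : G} (hg : ∀ a ∈ J, L (g * r a) < L g) {w : G}
    (hw : w ∈ Subgroup.closure (r '' J)) : L (g * w) + L w = L g := by
  induction hn : L w using Nat.strong_induction_on generalizing w with
  | _ n ih =>
  subst hn
  by_cases hw1 : w = 1
  · simp [hw1, h.one]
  obtain ⟨b, hb, hwb⟩ := h.exists_descent hw hw1
  have hbm : r b ∈ Subgroup.closure (r '' J) := Subgroup.subset_closure ⟨b, hb, rfl⟩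
  by_cases hu1 : w * r b = 1
  · have : w = r b := by rw [mul_eq_one_iff_eq_inv.mp hu1, h.inv_r]
    subst this
    have := h.length_eq_of_lt (hg b hb)
    omega
  obtain ⟨a, ha, hua⟩ := h.exists_descent (mul_mem hw hbm) hu1
  have ham : r a ∈ Subgroup.closure (r '' J) := Subgroup.subset_closure ⟨a, ha, rfl⟩
  obtain ⟨x, y, hy, rfl, hx⟩ := h.exists_coset_factorization {a, b} w
  have hsub : Subgroup.closure (r '' {a, b}) ≤ Subgroup.closure (r '' J) := by
    apply Subgroup.closure_mono
    apply Set.image_mono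
    rintro c (rfl | rfl) <;> assumption
  have ham' : r a ∈ Subgroup.closure (r '' {a, b}) := Subgroup.subset_closure ⟨a, by simp, rfl⟩
  have hbm' : r b ∈ Subgroup.closure (r '' {a, b}) := Subgroup.subset_closure ⟨b, by simp, rfl⟩
  have hxm : x ∈ Subgroup.closure (r '' J) := by
    have := mul_mem hw (inv_mem (hsub hy))
    rwa [mul_inv_cancel_right] at this
  have e1 := hx y hy
  have e2 := hx _ (mul_mem hy hbm')
  have e3 := hx _ (mul_mem (mul_mem hy hbm') ham')
  have e4 := hx _ ham'
  have e5 := hx _ hbm'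
  simp only [← mul_assoc] at e2 e3
  have s1 := h.length_eq_of_lt hwb
  have s2 := h.length_eq_of_lt hua
  have pa := h.pos a
  have pb := h.pos b
  have i0 := ih (L x) (by omega) hxm rfl
  have ia := ih (L (x * r a)) (by omega) (mul_mem hxm ham) rfl
  have ib := ih (L (x * r b)) (by omega) (mul_mem hxm hbm) rfl
  simp only [← mul_assoc] at ia ib
  have := h.length_mul_dihedral (a := a) (b := b) (g := g * x) (by omega) (by omega) hy
  rw [← mul_assoc]
  omega

/-! ### Independence of the reduced word -/

/-- Matsumoto's theorem. -/
theorem prod_map_eq_of_isRed {N : Type*} [Monoid N] {f : A → N}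
    (hf : ∀ a b, a ≠ b → orderOf (r a * r b) ≠ 0 →
      altProd (orderOf (r a * r b)) (f a) (f b) = altProd (orderOf (r a * r b)) (f b) (f a))
    {ω υ : List A} (hω : IsRed r L ω) (hυ : IsRed r L υ) (he : eval r ω = eval r υ) :
    (ω.map f).prod = (υ.map f).prod := by
  induction hn : weight r L ω using Nat.strong_induction_on generalizing ω υ with
  | _ n ih =>
  subst hn
  have hwt : weight r L ω = weight r L υ := by rw [← hω, ← hυ, he]
  -- words with the same last letter
  have same : ∀ (ω' υ' : List A) (a : A), weight r L (ω' ++ [a]) = weight r L ω →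
      IsRed r L (ω' ++ [a]) → IsRed r L (υ' ++ [a]) → eval r (ω' ++ [a]) = eval r (υ' ++ [a]) →
      ((ω' ++ [a]).map f).prod = ((υ' ++ [a]).map f).prod := by
    intro ω' υ' a hw h1 h2 h3
    have e : eval r ω' = eval r υ' := by simpa using h3
    have hpos := h.pos a
    have := ih (weight r L ω') (by simp at hw; omega) (h.isRed_append h1).1
      (h.isRed_append h2).1 e rfl
    simp [this]
  rcases List.eq_nil_or_concat' ω with rfl | ⟨ω', a, rfl⟩
  · rcases υ with _ | ⟨b, υ⟩
    · rfl
    · have := h.pos b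
      simp at hwt
      omega
  rcases List.eq_nil_or_concat' υ with rfl | ⟨υ', b, rfl⟩
  · have := h.pos a
    simp at hwt
    omega
  by_cases hab : a = b
  · subst hab
    exact same _ _ _ rfl hω hυ he
  have da : L (eval r (ω' ++ [a]) * r a) < L (eval r (ω' ++ [a])) := by
    have h1 := (h.isRed_append hω).2.2
    simp only [eval_append, eval_cons, eval_nil, mul_one, h.mul_cancel] at h1 ⊢
    have := h.pos a
    omega
  have db : L (eval r (ω' ++ [a]) * r b) < L (eval r (ω' ++ [a])) := by
    rw [he]
    have h1 := (h.isRed_append hυ).2.2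
    simp only [eval_append, eval_cons, eval_nil, mul_one, h.mul_cancel] at h1 ⊢
    have := h.pos b
    omega
  obtain ⟨x, y, hy, hg, hL, ya, yb⟩ := h.exists_dihedral_factorization da db
  obtain ⟨hm, hye⟩ := h.eq_alternatingWord_of_descents hy ya yb
  obtain ⟨η, hη, rfl⟩ := h.exists_isRed_univ x
  have hcomm := (h.eval_alternatingWord_comm a b _).mpr (pow_orderOf_eq_one _)
  have rab := h.isRed_alternatingWord_orderOf a b
  have rba := h.isRed_alternatingWord_orderOf b a
  have e : orderOf (r b * r a) = orderOf (r a * r b) := by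
    rw [← orderOf_inv, mul_inv_rev, h.inv_r, h.inv_r]
  rw [e] at rba
  have hbr := (prod_map_alternatingWord_comm f a b _).mpr (hf a b hab hm)
  generalize orderOf (r a * r b) = M at hm hye hcomm rab rba hbr
  obtain ⟨m, rfl⟩ := Nat.exists_eq_succ_of_ne_zero hm
  rw [Nat.succ_eq_add_one] at hye hcomm rab rba hbr
  have ra' : IsRed r L (η ++ alternatingWord b a (m + 1)) := by
    rw [IsRed, eval_append, weight_append, ← hcomm, ← hye, ← hg, hL, hη, hye, hcomm, rba]
  have rb' : IsRed r L (η ++ alternatingWord a b (m + 1)) := by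
    rw [IsRed, eval_append, weight_append, ← hye, ← hg, hL, hη, hye, rab]
  have ea : eval r (ω' ++ [a]) = eval r (η ++ alternatingWord b a (m + 1)) := by
    rw [hg, eval_append, hye, hcomm]
  have eb : eval r (ω' ++ [a]) = eval r (η ++ alternatingWord a b (m + 1)) := by
    rw [hg, eval_append, hye]
  have eL : (η ++ alternatingWord b a (m + 1)) = (η ++ alternatingWord a b m) ++ [a] := by
    rw [alternatingWord_succ, List.concat_eq_append, List.append_assoc]
  have eR : (η ++ alternatingWord a b (m + 1)) = (η ++ alternatingWord b a m) ++ [b] := by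
    rw [alternatingWord_succ, List.concat_eq_append, List.append_assoc]
  calc ((ω' ++ [a]).map f).prod = ((η ++ alternatingWord b a (m + 1)).map f).prod := by
        rw [eL] at ra' ea ⊢
        exact same _ _ _ rfl hω ra' ea
    _ = ((η ++ alternatingWord a b (m + 1)).map f).prod := by
        rw [List.map_append, List.map_append, List.prod_append, List.prod_append, hbr]
    _ = ((υ' ++ [b]).map f).prod := by
        rw [eR] at rb' eb ⊢
        refine same _ _ _ ?_ rb' hυ (eb.symm.trans he)
        rw [← rb', ← eb, hω]

end IsExchangeLength

namespace IsExchangeLength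

open CoxeterSystem (alternatingWord alternatingWord_succ alternatingWord_succ')
open CoxeterMatrix (altProd)

/-! ### Length-additive maps -/

/-- A map from `G` to a monoid that is multiplicative on products whose lengths add up. -/
structure LengthAdditive {G N : Type*} [Group G] [Monoid N] (L : G → ℕ) (F : G → N) : Prop where
  map_one : F 1 = 1
  map_mul : ∀ {u v}, L (u * v) = L u + L v → F (u * v) = F u * F v

section

variable {A G N : Type*} [Group G] [Monoid N] {r : A → G} {L : G → ℕ}
variable (h : IsExchangeLength r L)
include h

theorem lengthAdditive_of_words {F : G → N} {f : A → N}
    (hF : ∀ ω, IsRed r L ω → F (eval r ω) = (ω.map f).prod) : LengthAdditive L F where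
  map_one := by simpa using hF [] (by simp [IsRed, h.one])
  map_mul {u v} huv := by
    obtain ⟨ω, h1, rfl⟩ := h.exists_isRed_univ u
    obtain ⟨υ, h2, rfl⟩ := h.exists_isRed_univ v
    have h3 : IsRed r L (ω ++ υ) := by
      rw [IsRed, eval_append, huv, h1, h2, weight_append]
    rw [← eval_append, hF _ h1, hF _ h2, hF _ h3, List.map_append, List.prod_append]

/-- A family in a monoid satisfying the braid relations extends to a length-additive map. -/
theorem exists_lengthAdditive {f : A → N}
    (hf : ∀ a b, a ≠ b → orderOf (r a * r b) ≠ 0 →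
      altProd (orderOf (r a * r b)) (f a) (f b) = altProd (orderOf (r a * r b)) (f b) (f a)) :
    ∃ F : G → N, LengthAdditive L F ∧ ∀ a, F (r a) = f a := by
  choose ω h1 h2 using h.exists_isRed_univ
  have key : ∀ υ, IsRed r L υ → ((ω (eval r υ)).map f).prod = (υ.map f).prod :=
    fun υ hυ => h.prod_map_eq_of_isRed hf (h1 _) hυ (h2 _)
  refine ⟨fun g => ((ω g).map f).prod, h.lengthAdditive_of_words key, fun a => ?_⟩
  simpa using key [a] (by simp [IsRed])

theorem LengthAdditive.map_eval {F : G → N} (hF : LengthAdditive L F) {ω : List A}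
    (hω : IsRed r L ω) : F (eval r ω) = (ω.map fun a => F (r a)).prod := by
  induction ω with
  | nil => simpa using hF.map_one
  | cons a ω ih =>
    rw [← List.singleton_append] at hω
    obtain ⟨-, h1, h2⟩ := h.isRed_append hω
    rw [eval_cons, eval_nil, mul_one] at h2
    rw [eval_cons, hF.map_mul h2, ih h1, List.map_cons, List.prod_cons]

theorem LengthAdditive.altProd_comm {F : G → N} (hF : LengthAdditive L F) (a b : A) :
    altProd (orderOf (r a * r b)) (F (r a)) (F (r b)) =
      altProd (orderOf (r a * r b)) (F (r b)) (F (r a)) := by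
  have e : orderOf (r b * r a) = orderOf (r a * r b) := by
    rw [← orderOf_inv, mul_inv_rev, h.inv_r, h.inv_r]
  have h1 := h.isRed_alternatingWord_orderOf b a
  rw [e] at h1
  rw [← prod_map_alternatingWord_comm (fun a => F (r a)),
    ← hF.map_eval h (h.isRed_alternatingWord_orderOf a b), ← hF.map_eval h h1,
    (h.eval_alternatingWord_comm a b _).mpr (pow_orderOf_eq_one _)]

end

variable {A G : Type*} [Group G] {r : A → G} {L : G → ℕ}

/-- The sequence `v, x 0, x 1, …`. -/
def consSeq {G : Type*} (v : G) (x : ℕ → G) : ℕ → G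
  | 0 => v
  | n + 1 => x n

section Greatest

variable (h : IsExchangeLength r L)
include h

/-! ### The greatest prefix absorbed by a product -/

/-- `u` is a prefix of `w`: the weak order. -/
def IsPrefix (L : G → ℕ) (u w : G) : Prop := L u + L (u⁻¹ * w) = L w

theorem isPrefix_refl (u : G) : IsPrefix L u u := by simp [IsPrefix, h.one]

theorem IsPrefix.trans {u v w : G} (h1 : IsPrefix L u v) (h2 : IsPrefix L v w) :
    IsPrefix L u w := by
  have h3 := h.length_mul_le (u⁻¹ * v) (v⁻¹ * w)
  have h4 := h.length_mul_le u (u⁻¹ * w)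
  rw [mul_assoc, mul_inv_cancel_left] at h3
  rw [mul_inv_cancel_left] at h4
  simp only [IsPrefix] at *
  omega

theorem IsPrefix.antisymm {u v : G} (h1 : IsPrefix L u v) (h2 : IsPrefix L v u) : u = v := by
  simp only [IsPrefix] at *
  have := h.eq_one_of_length (g := u⁻¹ * v) (by omega)
  rwa [inv_mul_eq_one] at this

theorem length_remainder_trans {u v w : G} (h1 : IsPrefix L u v) (h2 : IsPrefix L v w) :
    L (u⁻¹ * w) = L (u⁻¹ * v) + L (v⁻¹ * w) := by
  have := IsPrefix.trans h h1 h2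
  simp only [IsPrefix] at *
  omega

/-- A proper prefix extends by a generator. -/
theorem exists_isPrefix_step {u w : G} (h1 : IsPrefix L u w) (hne : u ≠ w) :
    ∃ a, L u < L (u * r a) ∧ IsPrefix L (u * r a) w := by
  have hne' : (u⁻¹ * w)⁻¹ ≠ 1 := by
    rw [Ne, inv_eq_one, inv_mul_eq_one]
    exact hne
  obtain ⟨a, -, ha⟩ := h.exists_descent (J := Set.univ)
    (by rw [Set.image_univ, h.closure]; trivial) hne'
  have h2 := h.length_eq_of_lt ha
  have e : ((u⁻¹ * w)⁻¹ * r a)⁻¹ = r a * (u⁻¹ * w) := by rw [mul_inv_rev, inv_inv, h.inv_r]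
  rw [← h.inv (_ * r a), e, h.inv] at h2
  have h3 := h.length_mul_le (u * r a) (r a * (u⁻¹ * w))
  rw [mul_assoc, h.cancel_mul, mul_inv_cancel_left] at h3
  have h4 := h.step u a
  have h5 := h.pos a
  refine ⟨a, ?_, ?_⟩
  · simp only [IsPrefix] at *
    omega
  · simp only [IsPrefix, mul_inv_rev, h.inv_r, mul_assoc] at *
    omega

/-- The prefixes of `w` whose product with `v` has additive length have a greatest element. It is
found by going up from `1` one generator at a time; two different steps lead to the same result,
because both continue to the longest element of a dihedral subgroup. -/
theorem exists_greatest (v w : G) :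
    ∃ k, (IsPrefix L k w ∧ L (v * k) = L v + L k) ∧
      ∀ u, IsPrefix L u w → L (v * u) = L v + L u → IsPrefix L u k := by
  have main : ∀ n u, L w - L u = n → IsPrefix L u w → L (v * u) = L v + L u →
      ∃ k, (IsPrefix L k w ∧ L (v * k) = L v + L k) ∧ IsPrefix L u k ∧
        ∀ u', IsPrefix L u' w → L (v * u') = L v + L u' → IsPrefix L u u' →
          IsPrefix L u' k := by
    intro n
    induction n using Nat.strong_induction_on with
    | _ n ih =>
    intro u hn huw huv
    have down : ∀ {x y : G}, IsPrefix L x y → L (v * y) = L v + L y →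
        L (v * x) = L v + L x := by
      intro x y hx hy
      have h1 := h.length_mul_le v x
      have h2 := h.length_mul_le (v * x) (x⁻¹ * y)
      rw [mul_assoc, mul_inv_cancel_left] at h2
      simp only [IsPrefix] at hx
      omega
    have step : ∀ a, L u < L (u * r a) → IsPrefix L (u * r a) w →
        L (v * (u * r a)) = L v + L (u * r a) →
        ∃ k, (IsPrefix L k w ∧ L (v * k) = L v + L k) ∧ IsPrefix L (u * r a) k ∧
        ∀ u', IsPrefix L u' w → L (v * u') = L v + L u' → IsPrefix L (u * r a) u' →
          IsPrefix L u' k := by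
      intro a h1 h2 h3
      refine ih _ ?_ (u * r a) rfl h2 h3
      have : L (u * r a) ≤ L w := by simp only [IsPrefix] at h2; omega
      omega
    have hstep : ∀ a, L u < L (u * r a) → IsPrefix L u (u * r a) := by
      intro a ha
      have := h.length_mul_eq ha
      simp only [IsPrefix, inv_mul_cancel_left]
      omega
    by_cases hex : ∃ a, L u < L (u * r a) ∧ IsPrefix L (u * r a) w ∧
        L (v * (u * r a)) = L v + L (u * r a)
    · obtain ⟨a, a1, a2, a3⟩ := hex
      obtain ⟨k, ⟨k1, k2⟩, k3, k4⟩ := step a a1 a2 a3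
      refine ⟨k, ⟨k1, k2⟩, IsPrefix.trans h (hstep a a1) k3, fun u' u1 u2 u3 => ?_⟩
      by_cases hne : u = u'
      · subst hne
        exact IsPrefix.trans h (hstep a a1) k3
      obtain ⟨b, b1, b2⟩ := h.exists_isPrefix_step u3 hne
      have b3 := down b2 u2
      have b4 := IsPrefix.trans h b2 u1
      by_cases hab : a = b
      · subst hab
        exact k4 u' u1 u2 b2
      obtain ⟨k', ⟨k1', k2'⟩, k3', k4'⟩ := step b b1 b4 b3
      -- a common upper bound of `u * r a` and `u * r b`
      have desc : ∀ c, L u < L (u * r c) → IsPrefix L (u * r c) w →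
          L ((u⁻¹ * w)⁻¹ * r c) < L ((u⁻¹ * w)⁻¹) := by
        intro c c1 c2
        have e : ((u⁻¹ * w)⁻¹ * r c)⁻¹ = (u * r c)⁻¹ * w := by
          rw [mul_inv_rev, inv_inv, mul_inv_rev, mul_assoc]
        rw [← h.inv (_ * r c), e, h.inv]
        simp only [IsPrefix] at c2 huw
        omega
      obtain ⟨x, y, hy, e1, e2, e3, e4⟩ :=
        h.exists_dihedral_factorization (desc a a1 a2) (desc b b1 b4)
      have e5 : u⁻¹ * w = y⁻¹ * x⁻¹ := by rw [← mul_inv_rev, ← e1, inv_inv]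
      have hyw : IsPrefix L (u * y⁻¹) w ∧ L (u * y⁻¹) = L u + L y := by
        have h1 := h.length_mul_le u y⁻¹
        have h2 := h.length_mul_le (u * y⁻¹) x⁻¹
        rw [mul_assoc, ← e5, mul_inv_cancel_left, h.inv] at h2
        have h3 : (u * y⁻¹)⁻¹ * w = x⁻¹ := by
          rw [mul_inv_rev, inv_inv, mul_assoc, e5, mul_inv_cancel_left]
        simp only [IsPrefix, h3, h.inv] at huw ⊢
        rw [h.inv] at e2 h1
        omega
      have asc : ∀ c ∈ ({a, b} : Set A), L (v * u) < L (v * u * r c) := by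
        rintro c (rfl | rfl)
        · rw [mul_assoc]; omega
        · rw [mul_assoc]; omega
      have hyv : L (v * (u * y⁻¹)) = L v + L (u * y⁻¹) := by
        rw [← mul_assoc, h.length_mul_of_ascents asc (inv_mem hy), h.inv]
        omega
      have up : ∀ c, L u < L (u * r c) → L (y * r c) < L y →
          IsPrefix L (u * r c) (u * y⁻¹) := by
        intro c c1 c2
        have e : ((u * r c)⁻¹ * (u * y⁻¹)) = (y * r c)⁻¹ := by
          rw [mul_inv_rev, mul_inv_rev, mul_assoc, inv_mul_cancel_left]
        have := h.length_eq_of_lt c2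
        have := h.length_mul_eq c1
        rw [IsPrefix, e, h.inv]
        omega
      have q1 : IsPrefix L (u * r a) k' :=
        IsPrefix.trans h (up a a1 e3) (k4' _ hyw.1 hyv (up b b1 e4))
      exact IsPrefix.trans h (k4' u' u1 u2 b2) (k4 _ k1' k2' q1)
    · refine ⟨u, ⟨huw, huv⟩, h.isPrefix_refl u, fun u' u1 u2 u3 => ?_⟩
      by_cases hne : u = u'
      · subst hne
        exact h.isPrefix_refl u
      obtain ⟨b, b1, b2⟩ := h.exists_isPrefix_step u3 hne
      exact absurd ⟨b, b1, IsPrefix.trans h b2 u1, down b2 u2⟩ hex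
  obtain ⟨k, k1, -, k2⟩ := main _ 1 rfl (by simp [IsPrefix, h.one]) (by simp [h.one])
  exact ⟨k, k1, fun u u1 u2 => k2 u u1 u2 (by simp [IsPrefix, h.one])⟩

/-- The greatest prefix `u` of `w` such that the lengths add up in `v * u`. -/
noncomputable def absorb (v w : G) : G := (h.exists_greatest v w).choose

theorem absorb_isPrefix (v w : G) : IsPrefix L (h.absorb v w) w :=
  (h.exists_greatest v w).choose_spec.1.1

theorem length_mul_absorb (v w : G) : L (v * h.absorb v w) = L v + L (h.absorb v w) :=
  (h.exists_greatest v w).choose_spec.1.2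

theorem isPrefix_absorb {u v w : G} (h1 : IsPrefix L u w) (h2 : L (v * u) = L v + L u) :
    IsPrefix L u (h.absorb v w) :=
  (h.exists_greatest v w).choose_spec.2 u h1 h2

theorem absorb_eq_one {v w : G} (hvw : ∀ a, L v < L (v * r a) → ¬ L (r a * w) < L w) :
    h.absorb v w = 1 := by
  by_contra hne
  obtain ⟨a, a1, a2⟩ := h.exists_isPrefix_step (u := 1) (w := h.absorb v w)
    (by simp [IsPrefix, h.one]) (Ne.symm hne)
  rw [one_mul] at a1 a2
  have a3 := IsPrefix.trans h a2 (h.absorb_isPrefix v w)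
  have e := h.length_mul_absorb v w
  have h1 := h.length_mul_le (v * r a) ((r a)⁻¹ * h.absorb v w)
  rw [mul_assoc, mul_inv_cancel_left] at h1
  have := h.pos a
  rw [IsPrefix, h.inv_r] at a3
  rw [IsPrefix] at a2
  exact hvw a (by omega) (by omega)

theorem absorb_one_left (w : G) : h.absorb 1 w = w :=
  IsPrefix.antisymm h (h.absorb_isPrefix 1 w)
    (h.isPrefix_absorb (h.isPrefix_refl w) (by simp [h.one]))

theorem absorb_one_right (v : G) : h.absorb v 1 = 1 := by
  have := h.absorb_isPrefix v 1
  simp only [IsPrefix, h.one] at this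
  exact h.eq_one_of_length (by omega)

/-- Absorbing in two stages. -/
theorem absorb_mul {v u w : G} (hvu : L (v * u) = L v + L u) :
    h.absorb v (u * h.absorb u w) = u * h.absorb (v * u) w := by
  set k1 := h.absorb u w with hk1
  set k := h.absorb (v * u) w with hk
  have a1 := h.absorb_isPrefix (v * u) w
  have a2 := h.length_mul_absorb (v * u) w
  have b1 := h.absorb_isPrefix u w
  have b2 := h.length_mul_absorb u w
  rw [← hk] at a1 a2
  rw [← hk1] at b1 b2
  have s1 := h.length_mul_le u k
  have s2 := h.length_mul_le v (u * k)
  rw [← mul_assoc] at s2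
  have hkk1 : IsPrefix L k k1 := h.isPrefix_absorb a1 (by omega)
  have huk : IsPrefix L (u * k) (u * k1) := by
    have e : (u * k)⁻¹ * (u * k1) = k⁻¹ * k1 := by group
    rw [IsPrefix, e, b2]
    rw [IsPrefix] at hkk1
    omega
  refine IsPrefix.antisymm h ?_ (h.isPrefix_absorb huk (by rw [← mul_assoc]; omega))
  set k2 := h.absorb v (u * k1) with hk2
  have c1 := h.absorb_isPrefix v (u * k1)
  have c2 := h.length_mul_absorb v (u * k1)
  rw [← hk2] at c1 c2
  have d1 : IsPrefix L u k2 :=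
    h.isPrefix_absorb (by rw [IsPrefix, inv_mul_cancel_left, b2]) hvu
  have e1 : (u⁻¹ * k2)⁻¹ * k1 = k2⁻¹ * (u * k1) := by group
  have d2 : IsPrefix L (u⁻¹ * k2) k1 := by
    simp only [IsPrefix, e1] at *
    omega
  have d3 : IsPrefix L (u⁻¹ * k2) k := by
    refine h.isPrefix_absorb (IsPrefix.trans h d2 b1) ?_
    have e2 : v * u * (u⁻¹ * k2) = v * k2 := by group
    rw [e2]
    simp only [IsPrefix] at *
    omega
  have e3 : k2⁻¹ * (u * k) = (u⁻¹ * k2)⁻¹ * k := by group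
  simp only [IsPrefix, e3] at *
  omega

/-! ### The action on sequences -/

/-- The states of the transducer that multiplies a sequence by `v` on the left. -/
noncomputable def state (v : G) (x : ℕ → G) : ℕ → G
  | 0 => v
  | n + 1 => (h.absorb (state v x n) (x n))⁻¹ * x n

/-- Left multiplication by `v` of a sequence, thought of as an infinite product: the current state
takes over as much as possible of the next entry. -/
noncomputable def act (v : G) (x : ℕ → G) (n : ℕ) : G :=
  h.state v x n * h.absorb (h.state v x n) (x n)

theorem act_mul {v u : G} (hvu : L (v * u) = L v + L u) (x : ℕ → G) :
    h.act (v * u) x = h.act v (h.act u x) := by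
  have key : ∀ n, h.state (v * u) x n = h.state v (h.act u x) n * h.state u x n ∧
      L (h.state (v * u) x n) = L (h.state v (h.act u x) n) + L (h.state u x n) := by
    intro n
    induction n with
    | zero => exact ⟨rfl, hvu⟩
    | succ n ih =>
      simp only [state]
      obtain ⟨i1, i2⟩ := ih
      rw [i1] at i2 ⊢
      set V := h.state v (h.act u x) n
      set U := h.state u x n with hU
      have e : h.act u x n = U * h.absorb U (x n) := rfl
      rw [e, h.absorb_mul i2]
      have e1 : (U * h.absorb (V * U) (x n))⁻¹ * (U * h.absorb U (x n)) =
        (h.absorb (V * U) (x n))⁻¹ * h.absorb U (x n) := by group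
      rw [e1]
      refine ⟨by group, h.length_remainder_trans (h.isPrefix_absorb (h.absorb_isPrefix _ _) ?_)
        (h.absorb_isPrefix _ _)⟩
      have a2 := h.length_mul_absorb (V * U) (x n)
      have s1 := h.length_mul_le U (h.absorb (V * U) (x n))
      have s2 := h.length_mul_le V (U * h.absorb (V * U) (x n))
      rw [← mul_assoc] at s2
      omega
  funext n
  obtain ⟨k1, k2⟩ := key n
  rw [act, act, k1]
  rw [k1] at k2
  have e : h.act u x n = h.state u x n * h.absorb (h.state u x n) (x n) := rfl
  rw [e, h.absorb_mul k2, mul_assoc]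

theorem act_one (x : ℕ → G) : h.act 1 x = x := by
  have key : ∀ n, h.state 1 x n = 1 := by
    intro n
    induction n with
    | zero => rfl
    | succ n ih => rw [state, ih, absorb_one_left, inv_mul_cancel]
  funext n
  rw [act, key, absorb_one_left, one_mul]

theorem lengthAdditive_act :
    LengthAdditive (N := Function.End (ℕ → G)) L h.act where
  map_one := show h.act 1 = id from funext h.act_one
  map_mul {u v} huv := show h.act (u * v) = h.act u ∘ h.act v from funext (h.act_mul huv)

/-- A sequence is greedy if no entry can absorb anything from the next one. -/
def IsGreedy (x : ℕ → G) : Prop := ∀ n, h.absorb (x n) (x (n + 1)) = 1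

theorem act_of_isGreedy {v : G} {x : ℕ → G} (hx : h.IsGreedy (consSeq v x)) :
    h.act v x = consSeq v x := by
  have key : ∀ n, h.state v x n = consSeq v x n := by
    intro n
    induction n with
    | zero => rfl
    | succ n ih =>
      have : h.absorb (consSeq v x n) (x n) = 1 := hx n
      rw [state, ih, this, inv_one, one_mul]
      rfl
  funext n
  have : h.absorb (consSeq v x n) (x n) = 1 := hx n
  rw [act, key, this, mul_one]

theorem isGreedy_consSeq {v : G} {x : ℕ → G} (h0 : h.absorb v (x 0) = 1) (hx : h.IsGreedy x) :
    h.IsGreedy (consSeq v x)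
  | 0 => h0
  | n + 1 => hx n

theorem isGreedy_one : h.IsGreedy fun _ => 1 := fun _ => h.absorb_one_right 1

end Greatest

end IsExchangeLength

namespace CoxeterMatrix

open CoxeterSystem

universe v

variable {I : Type*}

/-! ### Actions of Artin-Tits groups -/

theorem map_altProd {G H : Type*} [Monoid G] [Monoid H] (φ : G →* H) (n : ℕ) (x y : G) :
    φ (altProd n x y) = altProd n (φ x) (φ y) := by
  induction n generalizing x y with
  | zero => simp [altProd]
  | succ n ih => simp [altProd, ih]

theorem altProd_artinGen (M : CoxeterMatrix I) {i j : I} (hij : M i j ≠ 0) :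
    altProd (M i j) (M.artinGen i) (M.artinGen j) =
      altProd (M i j) (M.artinGen j) (M.artinGen i) := by
  have h1 : PresentedGroup.mk M.artinRelators (altProd (M i j) (FreeGroup.of i) (FreeGroup.of j) *
      (altProd (M i j) (FreeGroup.of j) (FreeGroup.of i))⁻¹) = 1 :=
    PresentedGroup.one_of_mem ⟨i, j, hij, rfl⟩
  rw [map_mul, map_inv, mul_inv_eq_one, map_altProd, map_altProd] at h1
  exact h1

/-- A family satisfying the braid relations extends to the Artin-Tits group. -/
theorem exists_artinHom (M : CoxeterMatrix I) {G : Type*} [Group G] (f : I → G)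
    (hf : ∀ i j, M i j ≠ 0 → altProd (M i j) (f i) (f j) = altProd (M i j) (f j) (f i)) :
    ∃ φ : M.ArtinGroup →* G, ∀ i, φ (M.artinGen i) = f i := by
  have hr : ∀ x ∈ M.artinRelators, FreeGroup.lift f x = 1 := by
    rintro x ⟨i, j, hij, rfl⟩
    rw [map_mul, map_inv, map_altProd, map_altProd, FreeGroup.lift_apply_of,
      FreeGroup.lift_apply_of, hf i j hij, mul_inv_cancel]
  exact ⟨PresentedGroup.toGroup hr, fun i => PresentedGroup.toGroup.of hr⟩

/-- Maps `σ i` satisfying the braid relations act invertibly on the direct limit of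
`X → X → X → ⋯` along a map `δ` that commutes with them and that is a multiple of each of them.
Two elements of `X` have the same image in this direct limit only if some power of `δ` identifies
them. -/
theorem exists_perm_action (M : CoxeterMatrix I) {X : Type v} {σ σ' : I → Function.End X}
    {δ : Function.End X} (h1 : ∀ i, σ i * σ' i = δ) (h2 : ∀ i, σ' i * σ i = δ)
    (hσ : ∀ i j, M i j ≠ 0 → altProd (M i j) (σ i) (σ j) = altProd (M i j) (σ j) (σ i)) :
    ∃ (Y : Type v) (q : X → Y) (ρ : M.ArtinGroup →* Equiv.Perm Y),
      (∀ i x, ρ (M.artinGen i) (q x) = q (σ i x)) ∧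
        ∀ x y, q x = q y → ∃ n, (δ ^ n) x = (δ ^ n) y := by
  have c1 : ∀ i, Commute δ (σ i) := fun i => by
    rw [Commute, SemiconjBy]; nth_rewrite 1 [← h1 i]; rw [← h2 i, mul_assoc]
  have c2 : ∀ i, Commute δ (σ' i) := fun i => by
    rw [Commute, SemiconjBy]; nth_rewrite 1 [← h2 i]; rw [← h1 i, mul_assoc]
  -- the pair `(k, x)` stands for `δ⁻ᵏ x`
  let s : Setoid (ℕ × X) :=
    { r := fun p q => ∃ n, (δ ^ (n + q.1)) p.2 = (δ ^ (n + p.1)) q.2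
      iseqv :=
        { refl := fun p => ⟨0, rfl⟩
          symm := fun ⟨n, hn⟩ => ⟨n, hn.symm⟩
          trans := by
            rintro ⟨a, x⟩ ⟨b, y⟩ ⟨c, z⟩ ⟨n, hn⟩ ⟨m, hm⟩
            refine ⟨n + m + b, ?_⟩
            simp only at hn hm ⊢
            have e1 : δ ^ (n + m + b + c) = δ ^ (m + c) * δ ^ (n + b) := by
              rw [← pow_add]; congr 1; omega
            have e2 : δ ^ (m + c) * δ ^ (n + a) = δ ^ (n + a) * δ ^ (m + c) := by
              rw [← pow_add, ← pow_add, add_comm]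
            have e3 : δ ^ (n + m + b + a) = δ ^ (n + a) * δ ^ (m + b) := by
              rw [← pow_add]; congr 1; omega
            calc (δ ^ (n + m + b + c)) x = (δ ^ (m + c)) ((δ ^ (n + b)) x) := by rw [e1]; rfl
              _ = (δ ^ (m + c) * δ ^ (n + a)) y := by rw [hn]; rfl
              _ = (δ ^ (n + a)) ((δ ^ (m + c)) y) := by rw [e2]; rfl
              _ = (δ ^ (n + m + b + a)) z := by rw [hm, e3]; rfl } }
  have hcomm : ∀ (τ : Function.End X), Commute δ τ → ∀ (n : ℕ) (x : X),
      (δ ^ n) (τ x) = τ ((δ ^ n) x) := fun τ hτ n x => congrFun (hτ.pow_left n) x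
  let lift (τ : Function.End X) (hτ : Commute δ τ) (e : ℕ) : Quotient s → Quotient s :=
    Quotient.map (fun p => (p.1 + e, τ p.2)) (by
      rintro ⟨a, x⟩ ⟨b, y⟩ ⟨n, hn⟩
      refine ⟨n, ?_⟩
      simp only at hn ⊢
      rw [hcomm τ hτ, hcomm τ hτ]
      congr 1
      have e1 : ∀ k, δ ^ (n + (k + e)) = δ ^ e * δ ^ (n + k) := fun k => by
        rw [← pow_add]; congr 1; omega
      rw [e1, e1]
      exact congrArg (δ ^ e) hn)
  have hδ : ∀ (k : ℕ) (x : X), (⟦(k + 1, δ x)⟧ : Quotient s) = ⟦(k, x)⟧ := fun k x =>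
    Quotient.sound ⟨0, by
      simp only [zero_add]
      rw [pow_succ]
      rfl⟩
  let ρ' (i : I) : Equiv.Perm (Quotient s) :=
    { toFun := lift (σ i) (c1 i) 0
      invFun := lift (σ' i) (c2 i) 1
      left_inv := by
        rintro ⟨k, x⟩
        change (⟦(k + 1, (σ' i * σ i) x)⟧ : Quotient s) = ⟦(k, x)⟧
        rw [h2, hδ]
      right_inv := by
        rintro ⟨k, x⟩
        change (⟦(k + 1, (σ i * σ' i) x)⟧ : Quotient s) = ⟦(k, x)⟧
        rw [h1, hδ] }
  have halt : ∀ (i j : I) (n k : ℕ) (x : X),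
      (altProd n (ρ' i) (ρ' j) : Equiv.Perm (Quotient s)) ⟦(k, x)⟧ =
        ⟦(k, (altProd n (σ i) (σ j) : Function.End X) x)⟧ := by
    intro i j n
    induction n generalizing i j with
    | zero => intro k x; rfl
    | succ n ih =>
      intro k x
      rw [altProd, altProd, Equiv.Perm.mul_apply, ih]
      rfl
  obtain ⟨ρ, hρ⟩ := M.exists_artinHom ρ' fun i j hij => by
    ext ⟨k, x⟩
    change (altProd _ _ _ : Equiv.Perm (Quotient s)) ⟦(k, x)⟧ =
      (altProd _ _ _ : Equiv.Perm (Quotient s)) ⟦(k, x)⟧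
    rw [halt, halt, hσ i j hij]
  refine ⟨Quotient s, fun x => ⟦(0, x)⟧, ρ, fun i x => ?_, fun x y hxy => ?_⟩
  · rw [hρ]
    rfl
  · obtain ⟨n, hn⟩ := Quotient.exact hxy
    exact ⟨n, hn⟩

end CoxeterMatrix

namespace CoxeterSystem

variable {B W : Type*} [Group W] {M : CoxeterMatrix B} (cs : CoxeterSystem M W)

/-! ### The order of a product of two simple reflections -/

theorem geomReflection_single (M : CoxeterMatrix B) (i j : B) :
    geomReflection M i (Finsupp.single j 1) =
      Finsupp.single j 1 + (2 * Real.cos (Real.pi / M i j)) • Finsupp.single i 1 := by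
  rw [geomReflection, Module.reflection_apply, geomForm_single]
  module

theorem geomReflection_single_self (M : CoxeterMatrix B) (i : B) :
    geomReflection M i (Finsupp.single i 1) = - Finsupp.single i 1 := by
  rw [geomReflection, Module.reflection_apply_self]

/-- The powers of a product of two simple reflections on a simple root. -/
theorem geomReflection_mul_pow_single (M : CoxeterMatrix B) (i j : B) (n : ℕ) :
    Real.sin (Real.pi / M i j) • ((geomReflection M i * geomReflection M j) ^ n)
        (Finsupp.single i 1) =
      Real.sin ((2 * n + 1) * (Real.pi / M i j)) • Finsupp.single i (1 : ℝ) +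
        Real.sin (2 * n * (Real.pi / M i j)) • Finsupp.single j (1 : ℝ) := by
  set θ := Real.pi / M i j with hθ
  have hθ' : Real.pi / M j i = θ := by rw [M.symmetric j i]
  induction n with
  | zero => simp
  | succ n ih =>
    rw [pow_succ', LinearEquiv.mul_apply, LinearEquiv.mul_apply, ← map_smul, ← map_smul, ih,
      map_add, map_add, map_smul, map_smul, map_smul, map_smul, geomReflection_single M j i,
      geomReflection_single_self M j, map_add, map_neg, map_smul, geomReflection_single M i j,
      geomReflection_single_self M i, hθ', ← hθ]
    have e1 : Real.sin ((2 * n + 1) * θ) * (2 * Real.cos θ) =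
        Real.sin (2 * n * θ) + Real.sin (2 * (n + 1 : ℕ) * θ) := by
      have a1 : 2 * (n : ℝ) * θ = (2 * n + 1) * θ - θ := by ring
      have a2 : 2 * ((n + 1 : ℕ) : ℝ) * θ = (2 * n + 1) * θ + θ := by push_cast; ring
      rw [a1, a2, Real.sin_sub, Real.sin_add]
      ring
    have e2 : Real.sin (2 * (n + 1 : ℕ) * θ) * (2 * Real.cos θ) =
        Real.sin ((2 * n + 1) * θ) + Real.sin ((2 * (n + 1 : ℕ) + 1) * θ) := by
      have a1 : (2 * (n : ℝ) + 1) * θ = 2 * (n + 1 : ℕ) * θ - θ := by push_cast; ring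
      have a2 : (2 * ((n + 1 : ℕ) : ℝ) + 1) * θ = 2 * (n + 1 : ℕ) * θ + θ := by ring
      rw [a1, a2, Real.sin_sub, Real.sin_add]
      ring
    have e3 : Real.sin (2 * (n + 1 : ℕ) * θ) =
        Real.sin ((2 * n + 1) * θ) * (2 * Real.cos θ) - Real.sin (2 * n * θ) := by linarith
    have e4 : Real.sin ((2 * (n + 1 : ℕ) + 1) * θ) =
        (Real.sin ((2 * n + 1) * θ) * (2 * Real.cos θ) - Real.sin (2 * n * θ)) *
          (2 * Real.cos θ) - Real.sin ((2 * n + 1) * θ) := by rw [← e3]; linarith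
    rw [e3, e4]
    module

theorem geomReflection_mul_pow_single_of_eq_zero (M : CoxeterMatrix B) {i j : B} (hij : M i j = 0)
    (n : ℕ) : ((geomReflection M i * geomReflection M j) ^ n) (Finsupp.single i 1) =
      (2 * n + 1 : ℝ) • Finsupp.single i (1 : ℝ) + (2 * n : ℝ) • Finsupp.single j (1 : ℝ) := by
  have hji : M j i = 0 := by rw [M.symmetric j i, hij]
  induction n with
  | zero => simp
  | succ n ih =>
    rw [pow_succ', LinearEquiv.mul_apply, LinearEquiv.mul_apply, ih,
      map_add, map_add, map_smul, map_smul, map_smul, map_smul, geomReflection_single M j i,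
      geomReflection_single_self M j, map_add, map_neg, map_smul, geomReflection_single M i j,
      geomReflection_single_self M i, hij, hji]
    simp only [Nat.cast_zero, div_zero, Real.cos_zero]
    push_cast
    module

theorem orderOf_simple_mul_simple (i j : B) : orderOf (cs.simple i * cs.simple j) = M i j := by
  rcases eq_or_ne i j with rfl | hij
  · simp
  have hdvd : orderOf (cs.simple i * cs.simple j) ∣ M i j :=
    orderOf_dvd_of_pow_eq_one (cs.simple_mul_simple_pow i j)
  set m := orderOf (cs.simple i * cs.simple j) with hm
  have hpow : (geomReflection M i * geomReflection M j) ^ m = 1 := by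
    have := congrArg (cs.lift ⟨_, isLiftable_geomReflection M⟩)
      (pow_orderOf_eq_one (cs.simple i * cs.simple j))
    rwa [map_pow, map_mul, cs.lift_apply_simple (isLiftable_geomReflection M),
      cs.lift_apply_simple (isLiftable_geomReflection M), map_one] at this
  rcases Nat.eq_zero_or_pos (M i j) with h0 | h0
  · have h1 := geomReflection_mul_pow_single_of_eq_zero M h0 m
    rw [hpow] at h1
    have h2 := congrArg (fun f => f j) h1
    simp [hij] at h2
    omega
  have hm0 : 0 < m := Nat.pos_of_dvd_of_pos hdvd h0
  have hm1 : M i j ≠ 1 := M.off_diagonal i j hij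
  have h1 := geomReflection_mul_pow_single M i j m
  rw [hpow] at h1
  have h2 := congrArg (fun f => f j) h1
  have h3 := congrArg (fun f => f i) h1
  have hR : (0 : ℝ) < M i j := by exact_mod_cast h0
  have hR2 : (2 : ℝ) ≤ M i j := by exact_mod_cast (by omega : 2 ≤ M i j)
  obtain ⟨d, hd⟩ := hdvd
  -- the coordinate at `j` gives `sin (2π/d) = 0`, so `d ≤ 2`; the coordinate at `i` excludes `d = 2`
  have hd0 : 0 < d := Nat.pos_of_ne_zero (by rintro rfl; omega)
  have hmR : (0 : ℝ) < m := by exact_mod_cast hm0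
  have hdR : (0 : ℝ) < d := by exact_mod_cast hd0
  have hang : (m : ℝ) * (Real.pi / M i j) = Real.pi / d := by
    rw [hd]; push_cast; field_simp
  simp [hij, hij.symm] at h2 h3
  rw [mul_assoc, hang] at h2
  have hsin : 0 < Real.sin (Real.pi / M i j) := by
    apply Real.sin_pos_of_pos_of_lt_pi
    · positivity
    · rw [div_lt_iff₀ hR]
      nlinarith [Real.pi_pos]
  have hd12 : d = 1 ∨ d = 2 := by
    by_contra hne
    have h3d : (3 : ℝ) ≤ d := by exact_mod_cast (by omega : 3 ≤ d)
    have : 0 < Real.sin (2 * (Real.pi / d)) := by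
      apply Real.sin_pos_of_pos_of_lt_pi
      · positivity
      · rw [← mul_div_assoc, div_lt_iff₀ hdR]
        nlinarith [Real.pi_pos]
    first
      | exact this.ne' h2
      | exact this.ne h2
  rcases hd12 with rfl | rfl
  · omega
  · exfalso
    have e : (2 * (m : ℝ) + 1) * (Real.pi / M i j) = Real.pi / M i j + Real.pi := by
      have : (2 * (m : ℝ) + 1) * (Real.pi / M i j) =
        2 * (m * (Real.pi / M i j)) + Real.pi / M i j := by ring
      rw [this, hang]
      push_cast
      ring
    rw [e, Real.sin_add_pi] at h3
    linarith

end CoxeterSystem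

namespace IsExchangeLength

variable {A G : Type*} [Group G] {r : A → G} {L : G → ℕ}

section Top

/-! ### The longest element -/

variable (h : IsExchangeLength r L) {D : G} (hD : ∀ w, L (D * w) + L w = L D)
include h hD

theorem longest_mul_self : D * D = 1 :=
  h.eq_one_of_length (by have := hD D; omega)

theorem longest_inv : D⁻¹ = D := inv_eq_of_mul_eq_one_left (h.longest_mul_self hD)

theorem length_mul_longest (w : G) : L (w * D) + L w = L D := by
  rw [← h.inv (w * D), mul_inv_rev, h.longest_inv hD, ← h.inv w]
  exact hD w⁻¹

theorem length_longest_conj (w : G) : L (D * w * D) = L w := by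
  have h1 := h.length_mul_longest hD (D * w)
  have h2 := hD w
  omega

theorem absorb_longest (w : G) : h.absorb D w = 1 :=
  h.absorb_eq_one fun a ha => by
    have := hD (r a)
    omega

variable {N : Type*} [Monoid N] {F : G → N} (hF : LengthAdditive L F)
include hF

theorem LengthAdditive.map_longest_mul (v : G) : F D * F v = F (D * v * D) * F D := by
  have hDD := h.longest_mul_self hD
  have e1 : D * v⁻¹ * v = D := by group
  have e2 : D * v * D * (D * v⁻¹) = D := by
    rw [mul_assoc, ← mul_assoc D D, hDD, one_mul, mul_assoc, mul_inv_cancel, mul_one]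
  have h1 : F D = F (D * v⁻¹) * F v := by
    rw [← hF.map_mul, e1]
    rw [e1, ← h.inv v, hD]
  have h2 : F D = F (D * v * D) * F (D * v⁻¹) := by
    rw [← hF.map_mul, e2]
    rw [e2, h.length_longest_conj hD, ← hD v⁻¹, h.inv, add_comm]
  calc F D * F v = F (D * v * D) * (F (D * v⁻¹) * F v) := by rw [← mul_assoc, ← h2]
    _ = F (D * v * D) * F D := by rw [← h1]

theorem LengthAdditive.map_mul_complement (v : G) : F v * (F (v⁻¹ * D) * F D) = F D * F D := by
  rw [← mul_assoc, ← hF.map_mul]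
  · rw [mul_inv_cancel_left]
  · have := h.length_mul_longest hD v⁻¹
    rw [h.inv] at this
    rw [mul_inv_cancel_left]
    omega

theorem LengthAdditive.map_complement_mul (v : G) : F (v⁻¹ * D) * F D * F v = F D * F D := by
  have e : v⁻¹ * D * (D * v * D) = D := by
    rw [← mul_assoc, ← mul_assoc, mul_assoc v⁻¹, h.longest_mul_self hD, mul_one, inv_mul_cancel,
      one_mul]
  rw [mul_assoc, hF.map_longest_mul h hD, ← mul_assoc, ← hF.map_mul, e]
  have := h.length_mul_longest hD v⁻¹
  rw [h.inv] at this
  rw [e, h.length_longest_conj hD]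
  omega

end Top

section Greedy

/-! ### Greedy decompositions -/

/-- The sequence that begins with a list and continues with `1`. -/
def toSeq : List G → ℕ → G
  | [] => fun _ => 1
  | v :: l => consSeq v (toSeq l)

omit [Group G] in
theorem consSeq_inj {v v' : G} {x x' : ℕ → G} (hx : consSeq v x = consSeq v' x') :
    v = v' ∧ x = x' :=
  ⟨congrFun hx 0, funext fun n => congrFun hx (n + 1)⟩

theorem prod_map_eq_of_toSeq {N : Type*} [Monoid N] {F : G → N} (hF : F 1 = 1) {l l' : List G}
    (hl : toSeq l = toSeq l') : (l.map F).prod = (l'.map F).prod := by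
  have key : ∀ l : List G, toSeq l = toSeq [] → (l.map F).prod = 1 := by
    intro l
    induction l with
    | nil => intro; rfl
    | cons v l ih =>
      intro hl
      have h0 : v = 1 := congrFun hl 0
      have h1 : toSeq l = toSeq [] := funext fun n => congrFun hl (n + 1)
      rw [List.map_cons, List.prod_cons, ih h1, h0, hF, one_mul]
  induction l generalizing l' with
  | nil => exact (key l' hl.symm).symm
  | cons v l ih =>
    cases l' with
    | nil => exact key _ hl
    | cons v' l' =>
      obtain ⟨h0, h1⟩ := consSeq_inj hl
      rw [List.map_cons, List.prod_cons, List.map_cons, List.prod_cons, h0, ih h1]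

variable (h : IsExchangeLength r L)
include h

theorem isGreedy_toSeq {l : List G} (hl : l.IsChain fun v w => h.absorb v w = 1) :
    h.IsGreedy (toSeq l) := by
  induction l with
  | nil => exact h.isGreedy_one
  | cons v l ih =>
    cases l with
    | nil => exact h.isGreedy_consSeq (h.absorb_one_right v) h.isGreedy_one
    | cons w l =>
      rw [List.isChain_cons_cons] at hl
      exact h.isGreedy_consSeq hl.1 (ih hl.2)

theorem act_longest_iterate_injOn {D : G} (hD : ∀ w, L (D * w) + L w = L D) {n : ℕ} {x y : ℕ → G}
    (hx : h.IsGreedy x) (hy : h.IsGreedy y) (hxy : (h.act D)^[n] x = (h.act D)^[n] y) : x = y := by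
  induction n generalizing x y with
  | zero => exact hxy
  | succ n ih =>
    have gx := h.isGreedy_consSeq (h.absorb_longest hD (x 0)) hx
    have gy := h.isGreedy_consSeq (h.absorb_longest hD (y 0)) hy
    rw [Function.iterate_succ_apply, Function.iterate_succ_apply, h.act_of_isGreedy gx,
      h.act_of_isGreedy gy] at hxy
    exact (consSeq_inj (ih gx gy hxy)).2

/-- A product of values of a length-additive map can be rewritten so that no generator can be
moved from a factor to the preceding one. -/
theorem LengthAdditive.exists_greedy {N : Type*} [Monoid N] {F : G → N} (hF : LengthAdditive L F)
    (l : List G) : ∃ l' : List G, (l'.map F).prod = (l.map F).prod ∧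
      l'.IsChain fun v w => ∀ a, L v < L (v * r a) → ¬ L (r a * w) < L w := by
  suffices H : ∃ l' : List G, (l'.map F).prod = (l.map F).prod ∧
      (l'.map L).sum = (l.map L).sum ∧
      l'.IsChain fun v w => ∀ a, L v < L (v * r a) → ¬ L (r a * w) < L w from
    let ⟨l', h1, _, h2⟩ := H; ⟨l', h1, h2⟩
  induction hn : (l.map L).sum using Nat.strong_induction_on generalizing l with
  | _ n ih =>
  have strip : ∀ l : List G, ∃ l' : List G, (l'.map F).prod = (l.map F).prod ∧
      (l'.map L).sum = (l.map L).sum ∧ ∀ v ∈ l'.head?, 0 < L v := by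
    intro l
    induction l with
    | nil => exact ⟨[], rfl, rfl, by simp⟩
    | cons v l ihl =>
      rcases Nat.eq_zero_or_pos (L v) with h0 | h0
      · obtain ⟨l', h1, h2, h3⟩ := ihl
        refine ⟨l', ?_, ?_, h3⟩
        · rw [h1, h.eq_one_of_length h0]
          simp [hF.map_one]
        · rw [h2]
          simp [h0]
      · exact ⟨v :: l, rfl, rfl, by simpa using h0⟩
  obtain ⟨l1, p1, p2, p3⟩ := strip l
  rcases l1 with _ | ⟨v1, l1⟩
  · exact ⟨[], p1, by rw [p2, hn], List.isChain_nil⟩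
  have hv1 : 0 < L v1 := p3 v1 (by simp)
  -- choose the first factor as long as possible
  classical
  let Q : ℕ → Prop := fun k => ∃ (v : G) (l' : List G), L v = k ∧ L v + (l'.map L).sum = n ∧
    F v * (l'.map F).prod = (l.map F).prod
  have hQ1 : Q (L v1) := ⟨v1, l1, rfl, by simpa [hn] using p2, by simpa using p1⟩
  have hb : L v1 ≤ n := by simp at p2; omega
  obtain ⟨v, l', e1, e2, e3⟩ := Nat.findGreatest_spec (P := Q) hb hQ1
  have hle := Nat.le_findGreatest (P := Q) hb hQ1
  obtain ⟨l2, q1, q2, q3⟩ := ih (l'.map L).sum (by omega) l' rfl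
  refine ⟨v :: l2, by simpa [q1] using e3, by simpa [q2] using e2, ?_⟩
  cases l2 with
  | nil => exact List.isChain_singleton v
  | cons w l2 =>
    refine List.isChain_cons_cons.mpr ⟨fun a ha hw => ?_, q3⟩
    have hw' : L w = L (r a * w) + L (r a) := by
      rw [h.length_r_mul, ← h.inv w] at hw
      rw [h.length_r_mul, ← h.inv w]
      exact h.length_eq_of_lt hw
    have hva := h.length_mul_eq ha
    have hpos := h.pos a
    have hQ2 : Q (L (v * r a)) := by
      refine ⟨v * r a, (r a * w) :: l2, rfl, ?_, ?_⟩
      · simp only [List.map_cons, List.sum_cons] at q2 ⊢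
        omega
      · have e4 : F w = F (r a) * F (r a * w) := by
          rw [← hF.map_mul, h.cancel_mul]
          rw [h.cancel_mul]
          omega
        rw [← e3, ← q1, hF.map_mul hva, List.map_cons, List.prod_cons, List.map_cons,
          List.prod_cons, e4]
        simp only [mul_assoc]
    have h5 : L (v * r a) ≤ n := by
      simp only [List.map_cons, List.sum_cons] at q2
      omega
    have := Nat.le_findGreatest (P := Q) h5 hQ2
    omega

end Greedy

end IsExchangeLength

namespace CoxeterSystem

variable {B W : Type*} [Group W] {M : CoxeterMatrix B} (cs : CoxeterSystem M W)

/-! ### Coxeter systems -/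

theorem isExchangeLength : IsExchangeLength cs.simple cs.length where
  one := cs.length_one
  inv := cs.length_inv
  mul_self := cs.simple_mul_simple_self
  pos i := by simp
  inj := cs.simple_injective
  step w i := by
    have := cs.length_mul_simple w i
    rw [length_simple]
    omega
  exchange u i j h1 h2 := by
    obtain ⟨ω, hω, rfl⟩ := cs.exists_isReduced u
    have e : cs.simple i * cs.wordProd ω = cs.wordProd (i :: ω) := by rw [wordProd_cons]
    rw [e] at h2
    obtain ⟨k, hk, hk2, -⟩ := cs.exists_eraseIdx_of_length_mul_le (cs.isReflection_simple j)
      (i :: ω) h2.le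
    rcases k with _ | k
    · rw [e, List.eraseIdx_cons_zero] at *
      rw [← hk2, simple_mul_simple_cancel_right]
    · exfalso
      rw [List.eraseIdx_cons_succ, wordProd_cons, wordProd_cons, mul_assoc] at hk2
      rw [mul_left_cancel hk2] at h1
      have h3 := cs.length_wordProd_le (ω.eraseIdx k)
      have h4 := List.length_eraseIdx_le ω k
      have := hω.eq
      omega
  closure := cs.subgroup_closure_range_simple

end CoxeterSystem

namespace CoxeterMatrix

open IsExchangeLength

variable {I : Type*} (M : CoxeterMatrix I)

theorem isRed_simple_iff (ω : List I) :
    IsRed M.toCoxeterSystem.simple M.toCoxeterSystem.length ω ↔ M.toCoxeterSystem.IsReduced ω := by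
  have : weight M.toCoxeterSystem.simple M.toCoxeterSystem.length ω = ω.length := by
    simp only [weight, CoxeterSystem.length_simple]
    simp
  rw [IsRed, this]
  rfl

theorem prod_artinGen_eq {ω υ : List I}
    (hω : IsRed M.toCoxeterSystem.simple M.toCoxeterSystem.length ω)
    (hυ : IsRed M.toCoxeterSystem.simple M.toCoxeterSystem.length υ)
    (he : eval M.toCoxeterSystem.simple ω = eval M.toCoxeterSystem.simple υ) :
    (ω.map M.artinGen).prod = (υ.map M.artinGen).prod := by
  refine M.toCoxeterSystem.isExchangeLength.prod_map_eq_of_isRed (fun i j _ hij => ?_) hω hυ he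
  rw [CoxeterSystem.orderOf_simple_mul_simple] at hij ⊢
  exact M.altProd_artinGen hij

theorem simpleElement_eval {ω : List I}
    (hω : IsRed M.toCoxeterSystem.simple M.toCoxeterSystem.length ω) :
    M.simpleElement (eval M.toCoxeterSystem.simple ω) = (ω.map M.artinGen).prod := by
  have h := (M.toCoxeterSystem.exists_isReduced (eval M.toCoxeterSystem.simple ω)).choose_spec
  exact M.prod_artinGen_eq ((M.isRed_simple_iff _).mpr h.1) hω h.2.symm

theorem lengthAdditive_simpleElement :
    LengthAdditive M.toCoxeterSystem.length M.simpleElement :=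
  M.toCoxeterSystem.isExchangeLength.lengthAdditive_of_words fun _ hω => M.simpleElement_eval hω

namespace SphericalPartition

variable {M} (P : SphericalPartition M)

/-! ### The subgroup generated by the longest elements of the blocks -/

/-- The longest element of a block, as an element of the subgroup that these elements generate. -/
noncomputable def gen (α : P.blocks) : P.coxeterSubgroup :=
  ⟨P.longest α, Subgroup.subset_closure ⟨α, rfl⟩⟩

/-- The Coxeter length of the ambient group, restricted to the subgroup. -/
noncomputable def len (w : P.coxeterSubgroup) : ℕ := M.toCoxeterSystem.length (w : M.Group)

variable {P}

/-- By admissibility, all `i ∈ α` are ascents, or all are descents, of an element of the subgroup;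
accordingly `longest α` is added or split off with additive lengths. -/
theorem IsAdmissible.ascents_or_descents (hP : P.IsAdmissible) (w : P.coxeterSubgroup)
    (α : P.blocks) :
    ((∀ i ∈ (α : Set I), M.toCoxeterSystem.length w <
        M.toCoxeterSystem.length (w * M.toCoxeterSystem.simple i)) ∧
      P.len (w * P.gen α) = P.len w + P.len (P.gen α)) ∨
    ((∀ i ∈ (α : Set I), M.toCoxeterSystem.length (w * M.toCoxeterSystem.simple i) <
        M.toCoxeterSystem.length w) ∧
      P.len w = P.len (w * P.gen α) + P.len (P.gen α)) := by
  have hmem := (P.isLongest_longest α).1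
  rcases hP w w.2 α α.2 with h1 | h1
  · have h2 : ∀ i ∈ (α : Set I), M.toCoxeterSystem.length w <
        M.toCoxeterSystem.length (w * M.toCoxeterSystem.simple i) := fun i hi => by
      have : M.toCoxeterSystem.length (w * M.toCoxeterSystem.simple i) =
        M.toCoxeterSystem.length w + 1 := h1 hi
      omega
    exact Or.inl ⟨h2, M.toCoxeterSystem.isExchangeLength.length_mul_of_ascents h2 hmem⟩
  · have h2 : ∀ i ∈ (α : Set I), M.toCoxeterSystem.length (w * M.toCoxeterSystem.simple i) <
        M.toCoxeterSystem.length w := fun i hi => by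
      have : M.toCoxeterSystem.length (w * M.toCoxeterSystem.simple i) + 1 =
        M.toCoxeterSystem.length w := h1 hi
      omega
    exact Or.inr ⟨h2,
      (M.toCoxeterSystem.isExchangeLength.length_mul_of_descents h2 hmem).symm⟩

theorem len_gen_pos (α : P.blocks) : 0 < P.len (P.gen α) := by
  obtain ⟨i, hi⟩ := Setoid.nonempty_of_mem_partition P.isPartition α.2
  have := (P.isLongest_longest α).2 _ (Subgroup.subset_closure ⟨i, hi, rfl⟩)
  rw [CoxeterSystem.length_simple] at this
  exact this

/-- An element of the parabolic subgroup of `α` having all `i ∈ α` as descents is the longest. -/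
theorem eq_longest_of_descents {α : P.blocks} {y : M.Group}
    (hy : y ∈ M.toCoxeterSystem.parabolic α)
    (hd : ∀ i ∈ (α : Set I), M.toCoxeterSystem.length (y * M.toCoxeterSystem.simple i) <
      M.toCoxeterSystem.length y) : y = P.longest α := by
  have hl := P.isLongest_longest α
  have h1 := M.toCoxeterSystem.isExchangeLength.length_mul_of_descents hd
    (mul_mem (inv_mem hy) hl.1)
  rw [mul_inv_cancel_left] at h1
  have h2 := hl.2 y hy
  have h3 := M.toCoxeterSystem.isExchangeLength.eq_one_of_length
    (g := y⁻¹ * P.longest α) (by omega)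
  exact inv_mul_eq_one.mp h3

theorem IsAdmissible.exchange (hP : P.IsAdmissible) (u : P.coxeterSubgroup) (α β : P.blocks)
    (h1 : P.len u < P.len (u * P.gen β))
    (h2 : P.len (P.gen α * u * P.gen β) < P.len (P.gen α * u)) :
    P.gen α * u = u * P.gen β := by
  set cs := M.toCoxeterSystem with hcs
  have hE := cs.isExchangeLength
  have hpa := P.len_gen_pos α
  have hpb := P.len_gen_pos β
  have len_inv : ∀ w, P.len w⁻¹ = P.len w := fun w => cs.length_inv w
  have gen_inv : (P.gen α)⁻¹ = P.gen α :=
    Subtype.ext (inv_eq_of_mul_eq_one_left (P.longest_mul_self α))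
  have e0 : P.len (u⁻¹ * P.gen α) = P.len (P.gen α * u) := by
    rw [← len_inv, mul_inv_rev, inv_inv, gen_inv]
  -- `longest α * u` has additive length
  rcases hP.ascents_or_descents u⁻¹ α with ⟨a1, a2⟩ | ⟨a1, a2⟩
  swap
  · exfalso
    rw [len_inv, e0] at a2
    have h3 : P.len (u * P.gen β) ≤ P.len (P.gen α) + P.len (P.gen α * u * P.gen β) := by
      have := hE.length_mul_le (P.gen α : M.Group) (P.gen α * u * P.gen β : P.coxeterSubgroup)
      have e : (P.gen α : M.Group) * (P.gen α * u * P.gen β : P.coxeterSubgroup) =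
          (u * P.gen β : P.coxeterSubgroup) := by
        have := P.longest_mul_self α
        change P.longest α * (P.longest α * u * P.longest β) = u * P.longest β
        rw [← mul_assoc, ← mul_assoc, this, one_mul]
      rw [e] at this
      exact this
    omega
  rcases hP.ascents_or_descents u β with ⟨b1, -⟩ | ⟨-, b2⟩
  swap
  · omega
  rcases hP.ascents_or_descents (P.gen α * u) β with ⟨-, c2⟩ | ⟨c1, -⟩
  · omega
  -- conjugation by `u` maps the parabolic subgroup of `β` into that of `α`
  have hsimple : ∀ j ∈ (β : Set I), (u : M.Group) * cs.simple j * (u : M.Group)⁻¹ ∈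
      cs.parabolic α := by
    intro j hj
    obtain ⟨η, k1, k2, k3⟩ := hE.exists_isRed (P.isLongest_longest α).1
    obtain ⟨η', m1, -, m3⟩ := hE.exchange_word (u := u) (b := j) (b1 j hj) η
      (by rw [k3]; exact c1 j hj)
    have e : (u : M.Group) * cs.simple j * (u : M.Group)⁻¹ =
        (eval cs.simple η)⁻¹ * eval cs.simple η' := by
      rw [eq_inv_mul_iff_mul_eq, ← mul_assoc, ← mul_assoc, m3, mul_inv_cancel_right]
    rw [e]
    exact mul_mem (inv_mem (eval_mem k1)) (eval_mem fun a ha => k1 a (m1 a ha))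
  have hconj : ∀ z ∈ cs.parabolic β, (u : M.Group) * z * (u : M.Group)⁻¹ ∈ cs.parabolic α := by
    have : cs.parabolic β ≤ (cs.parabolic α).comap (MulAut.conj (u : M.Group)).toMonoidHom := by
      rw [CoxeterSystem.parabolic, Subgroup.closure_le]
      rintro _ ⟨j, hj, rfl⟩
      exact hsimple j hj
    exact fun z hz => this hz
  set y := (u : M.Group) * P.longest β * (u : M.Group)⁻¹ with hy
  have hym : y ∈ cs.parabolic α := hconj _ (P.isLongest_longest β).1
  have hyy : y⁻¹ = y := by
    have := inv_eq_of_mul_eq_one_left (P.longest_mul_self β)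
    rw [hy, mul_inv_rev, mul_inv_rev, inv_inv, this, mul_assoc]
  have hadd : ∀ z ∈ cs.parabolic α, cs.length ((u : M.Group)⁻¹ * z) =
      cs.length (u : M.Group)⁻¹ + cs.length z := fun z hz => hE.length_mul_of_ascents a1 hz
  have e1 : (((u * P.gen β)⁻¹ : P.coxeterSubgroup) : M.Group) = (u : M.Group)⁻¹ * y := by
    have : ((u : M.Group) * P.longest β)⁻¹ = (u : M.Group)⁻¹ * y := by
      rw [← hyy, hy]; group
    exact this
  have hy1 : y ≠ 1 := by
    intro hy1
    have h3 : P.longest β = 1 := by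
      rw [hy] at hy1
      have : P.longest β = (u : M.Group)⁻¹ * 1 * u := by rw [← hy1]; group
      rw [this]; group
    have : P.len (P.gen β) = 0 := by
      change cs.length (P.longest β) = 0
      rw [h3, cs.length_one]
    omega
  have hs : ∀ i ∈ (α : Set I), cs.simple i ∈ cs.parabolic α :=
    fun i hi => Subgroup.subset_closure ⟨i, hi, rfl⟩
  have hydesc : ∀ i ∈ (α : Set I), cs.length (y * cs.simple i) < cs.length y := by
    rcases hP.ascents_or_descents (u * P.gen β)⁻¹ α with ⟨d1, -⟩ | ⟨d1, -⟩
    · obtain ⟨i, hi, hi2⟩ := hE.exists_descent hym hy1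
      have := d1 i hi
      rw [e1, mul_assoc, hadd _ hym, hadd _ (mul_mem hym (hs i hi))] at this
      omega
    · intro i hi
      have := d1 i hi
      rw [e1, mul_assoc, hadd _ hym, hadd _ (mul_mem hym (hs i hi))] at this
      omega
  have hyl := P.eq_longest_of_descents hym hydesc
  apply Subtype.ext
  change P.longest α * (u : M.Group) = u * P.longest β
  rw [← hyl, hy, inv_mul_cancel_right]

/-- The subgroup of an admissible partition, with the length of the ambient group. -/
theorem IsAdmissible.isExchangeLength (hP : P.IsAdmissible) : IsExchangeLength P.gen P.len where
  one := M.toCoxeterSystem.length_one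
  inv w := M.toCoxeterSystem.length_inv w
  mul_self α := Subtype.ext (P.longest_mul_self α)
  pos := len_gen_pos
  inj α β h := P.longest_injective (congrArg Subtype.val h)
  step w α := (hP.ascents_or_descents w α).imp And.right And.right
  exchange := hP.exchange
  closure := by
    have : Set.range P.gen = ((↑) : P.coxeterSubgroup → M.Group) ⁻¹' Set.range P.longest := by
      ext w
      constructor
      · rintro ⟨α, rfl⟩
        exact ⟨α, rfl⟩
      · rintro ⟨α, hα⟩
        exact ⟨α, Subtype.ext hα⟩
    rw [this]
    exact Subgroup.closure_closure_coe_preimage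

theorem finite_coxeterSubgroup (hsph : P.type.IsSpherical) : Finite P.coxeterSubgroup := by
  have : Finite P.type.Group := hsph
  have hl : P.type.IsLiftable P.longest := fun α β => pow_orderOf_eq_one _
  have hle : P.coxeterSubgroup ≤ (P.type.toCoxeterSystem.lift ⟨P.longest, hl⟩).range := by
    rw [coxeterSubgroup, Subgroup.closure_le]
    rintro _ ⟨α, rfl⟩
    exact ⟨_, P.type.toCoxeterSystem.lift_apply_simple hl α⟩
  have : Finite (P.type.toCoxeterSystem.lift ⟨P.longest, hl⟩).range :=
    Set.finite_range _
  exact Finite.Set.subset _ hle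

/-- The longest element of the subgroup is the longest element of the whole Coxeter group. -/
theorem IsAdmissible.exists_longest (hP : P.IsAdmissible) (hsph : P.type.IsSpherical) :
    ∃ D : P.coxeterSubgroup, ∀ w : M.Group,
      M.toCoxeterSystem.length (D * w) + M.toCoxeterSystem.length w =
        M.toCoxeterSystem.length (D : M.Group) := by
  have := P.finite_coxeterSubgroup hsph
  obtain ⟨D, hD⟩ := Finite.exists_max P.len
  refine ⟨D, fun w => ?_⟩
  have hE := M.toCoxeterSystem.isExchangeLength
  refine hE.length_mul_of_descents (J := Set.univ) (fun i _ => ?_)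
    (by rw [Set.image_univ, hE.closure]; trivial)
  obtain ⟨α, ⟨hα, hi⟩, -⟩ := P.isPartition.2 i
  rcases hP.ascents_or_descents D ⟨α, hα⟩ with ⟨-, h1⟩ | ⟨h1, -⟩
  · have := hD (D * P.gen ⟨α, hα⟩)
    have := P.len_gen_pos ⟨α, hα⟩
    omega
  · exact h1 i hi

theorem lengthAdditive_simpleElement_coe :
    LengthAdditive P.len fun w : P.coxeterSubgroup => M.simpleElement w where
  map_one := M.lengthAdditive_simpleElement.map_one
  map_mul huv := M.lengthAdditive_simpleElement.map_mul huv

theorem orderOf_gen (α β : P.blocks) : orderOf (P.gen α * P.gen β) = P.type α β :=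
  (Subgroup.orderOf_coe (P.gen α * P.gen β)).symm

/-- A greedy pair in the subgroup is greedy in the Coxeter group: a simple reflection that could be
moved drags the longest element of its block along. -/
theorem IsAdmissible.absorb_eq_one (hP : P.IsAdmissible) {v w : P.coxeterSubgroup}
    (hvw : ∀ α, P.len v < P.len (v * P.gen α) → ¬ P.len (P.gen α * w) < P.len w) :
    M.toCoxeterSystem.isExchangeLength.absorb (v : M.Group) w = 1 := by
  have hE := M.toCoxeterSystem.isExchangeLength
  refine hE.absorb_eq_one fun i h1 h2 => ?_
  obtain ⟨α, ⟨hα, hi⟩, -⟩ := P.isPartition.2 i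
  have hpos := P.len_gen_pos ⟨α, hα⟩
  refine hvw ⟨α, hα⟩ ?_ ?_
  · rcases hP.ascents_or_descents v ⟨α, hα⟩ with ⟨-, h3⟩ | ⟨h3, -⟩
    · omega
    · have := h3 i hi
      omega
  · rw [hE.length_r_mul, ← hE.inv (w : M.Group)] at h2
    rw [hP.isExchangeLength.length_r_mul, ← hP.isExchangeLength.inv w]
    rcases hP.ascents_or_descents w⁻¹ ⟨α, hα⟩ with ⟨h3, -⟩ | ⟨-, h3⟩
    · have h4 := h3 i hi
      rw [Subgroup.coe_inv] at h4
      omega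
    · omega

end SphericalPartition

end CoxeterMatrix

namespace CoxeterMatrix

open IsExchangeLength

variable {I : Type*} {M : CoxeterMatrix I}

/-! ### Faithfulness on greedy products -/

/-- If the Coxeter group has a longest element, two products of simple elements that are equal in
the Artin-Tits group come from the same greedy list. -/
theorem prod_simpleElement_injOn {D : M.Group}
    (hD : ∀ w, M.toCoxeterSystem.length (D * w) + M.toCoxeterSystem.length w =
      M.toCoxeterSystem.length D) {l l' : List M.Group}
    (hl : l.IsChain fun v w => M.toCoxeterSystem.isExchangeLength.absorb v w = 1)
    (hl' : l'.IsChain fun v w => M.toCoxeterSystem.isExchangeLength.absorb v w = 1)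
    (he : (l.map M.simpleElement).prod = (l'.map M.simpleElement).prod) :
    toSeq l = toSeq l' := by
  set cs := M.toCoxeterSystem with hcs
  have hE := cs.isExchangeLength
  have hF := hE.lengthAdditive_act
  let F : M.Group → Function.End (ℕ → M.Group) := hE.act
  obtain ⟨Y, q, ρ, h1, h2⟩ := M.exists_perm_action (σ := fun i => F (cs.simple i))
    (σ' := fun i => F ((cs.simple i)⁻¹ * D) * F D) (δ := F D * F D)
    (fun i => hF.map_mul_complement hE hD _) (fun i => hF.map_complement_mul hE hD _)
    (fun i j _ => by
      have := hF.altProd_comm hE i j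
      rwa [CoxeterSystem.orderOf_simple_mul_simple] at this)
  have hact : ∀ w x, ρ (M.simpleElement w) (q x) = q (F w x) := by
    intro w x
    obtain ⟨ω, hω, rfl⟩ := hE.exists_isRed_univ w
    have hmap : F (eval cs.simple ω) = (ω.map fun i => F (cs.simple i)).prod :=
      hF.map_eval hE hω
    rw [M.simpleElement_eval hω, hmap]
    clear hω hmap
    induction ω with
    | nil =>
      rw [List.map_nil, List.prod_nil, map_one]
      rfl
    | cons i ω ih =>
      rw [List.map_cons, List.prod_cons, map_mul, Equiv.Perm.mul_apply, ih, h1]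
      rfl
  have hgreedy : ∀ l : List M.Group, (l.IsChain fun v w => hE.absorb v w = 1) →
      ρ (l.map M.simpleElement).prod (q (toSeq [])) = q (toSeq l) := by
    intro l hl
    induction l with
    | nil => simp
    | cons v l ih =>
      rw [List.map_cons, List.prod_cons, map_mul, Equiv.Perm.mul_apply, ih hl.tail, hact]
      congr 1
      exact hE.act_of_isGreedy (hE.isGreedy_toSeq hl)
  have hq : q (toSeq l) = q (toSeq l') := by rw [← hgreedy l hl, ← hgreedy l' hl', he]
  obtain ⟨n, hn⟩ := h2 _ _ hq
  have hpow : ∀ x, ((F D * F D) ^ n : Function.End (ℕ → M.Group)) x = (hE.act D)^[2 * n] x := by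
    intro x
    have e := hom_coe_pow (fun f : Function.End (ℕ → M.Group) => (f : (ℕ → M.Group) → _)) rfl
      (fun _ _ => rfl) (F D * F D) n
    have e' := congrFun e x
    rw [Function.iterate_mul]
    exact e'
  rw [hpow, hpow] at hn
  exact hE.act_longest_iterate_injOn hD (hE.isGreedy_toSeq hl) (hE.isGreedy_toSeq hl') hn

/-- If `δ` is central and each generator divides it with a positive quotient, every element
becomes positive after multiplication by a power of `δ`. -/
theorem exists_pow_mul_eq_prod {N : CoxeterMatrix I} {δ : N.ArtinGroup}
    (hδ : ∀ i, ∃ ω : List I, δ * (N.artinGen i)⁻¹ = (ω.map N.artinGen).prod)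
    (hc : ∀ i, Commute δ (N.artinGen i)) (b : N.ArtinGroup) :
    ∃ (n : ℕ) (ω : List I), δ ^ n * b = (ω.map N.artinGen).prod := by
  have htop : b ∈ Subgroup.closure (Set.range N.artinGen) := by
    have : Subgroup.closure (Set.range N.artinGen) = ⊤ := PresentedGroup.closure_range_of _
    rw [this]
    trivial
  have hcb : ∀ x ∈ Subgroup.closure (Set.range N.artinGen), Commute δ x := by
    intro x hx
    have : Subgroup.closure (Set.range N.artinGen) ≤ Subgroup.centralizer {δ} := by
      rw [Subgroup.closure_le]
      rintro _ ⟨i, rfl⟩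
      exact Subgroup.mem_centralizer_singleton_iff.mpr (hc i).symm
    exact (Subgroup.mem_centralizer_singleton_iff.mp (this hx)).symm
  induction htop using Subgroup.closure_induction_right with
  | one => exact ⟨0, [], by simp⟩
  | mul_right x hx y hy ih =>
    obtain ⟨i, rfl⟩ := hy
    obtain ⟨n, ω, h⟩ := ih
    exact ⟨n, ω ++ [i], by rw [← mul_assoc, h]; simp⟩
  | mul_inv_cancel x hx y hy ih =>
    obtain ⟨i, rfl⟩ := hy
    obtain ⟨n, ω, h⟩ := ih
    obtain ⟨υ, hυ⟩ := hδ i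
    refine ⟨n + 1, ω ++ υ, ?_⟩
    rw [List.map_append, List.prod_append, ← h, ← hυ, pow_succ, mul_assoc, ← mul_assoc δ,
      (hcb x hx).eq]
    simp only [mul_assoc]

namespace SphericalPartition

variable {P : SphericalPartition M}

/-! ### The homomorphism between Artin-Tits groups -/

theorem IsAdmissible.exists_hom (hP : P.IsAdmissible) :
    ∃ φ : P.type.ArtinGroup →* M.ArtinGroup, ∀ α, φ (P.type.artinGen α) = P.artinLongest α := by
  refine P.type.exists_artinHom P.artinLongest fun α β _ => ?_
  have := P.lengthAdditive_simpleElement_coe.altProd_comm hP.isExchangeLength α β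
  rwa [orderOf_gen] at this

theorem IsAdmissible.hom_injective (hP : P.IsAdmissible) (hsph : P.type.IsSpherical)
    {φ : P.type.ArtinGroup →* M.ArtinGroup}
    (hφ : ∀ α, φ (P.type.artinGen α) = P.artinLongest α) : Function.Injective φ := by
  have hE := hP.isExchangeLength
  have hW := M.toCoxeterSystem.isExchangeLength
  obtain ⟨D, hD⟩ := hP.exists_longest hsph
  have hD' : ∀ w, P.len (D * w) + P.len w = P.len D := fun w => hD w
  -- the section of the subgroup in the Artin-Tits group of the type
  obtain ⟨F, hF, hFgen⟩ := hE.exists_lengthAdditive (f := P.type.artinGen) fun α β _ hαβ => by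
    rw [orderOf_gen] at hαβ ⊢
    exact P.type.altProd_artinGen hαβ
  have hFeval : ∀ w, ∃ ω : List P.blocks, F w = (ω.map P.type.artinGen).prod := by
    intro w
    obtain ⟨ω, hω, rfl⟩ := hE.exists_isRed_univ w
    exact ⟨ω, by simp only [hF.map_eval hE hω, hFgen]⟩
  have hφF : ∀ w, φ (F w) = M.simpleElement w := by
    intro w
    obtain ⟨ω, hω, rfl⟩ := hE.exists_isRed_univ w
    have h1 := P.lengthAdditive_simpleElement_coe.map_eval hE hω
    rw [h1, hF.map_eval hE hω, map_list_prod, List.map_map]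
    congr 2
    funext α
    rw [Function.comp_apply, hFgen, hφ]
    rfl
  rw [injective_iff_map_eq_one]
  intro b hb
  obtain ⟨n, ω, hω⟩ := exists_pow_mul_eq_prod (N := P.type) (δ := F D * F D)
    (fun α => by
      obtain ⟨υ, hυ⟩ := hFeval ((P.gen α)⁻¹ * D)
      obtain ⟨υ', hυ'⟩ := hFeval D
      refine ⟨υ ++ υ', ?_⟩
      rw [← hF.map_complement_mul hE hD' (P.gen α), hFgen, mul_inv_cancel_right, hυ, hυ',
        List.map_append, List.prod_append])
    (fun α => by
      have h1 := hF.map_mul_complement hE hD' (P.gen α)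
      have h2 := hF.map_complement_mul hE hD' (P.gen α)
      rw [hFgen] at h1 h2
      rw [Commute, SemiconjBy]
      nth_rewrite 1 [← h1]
      rw [← h2, mul_assoc]) b
  obtain ⟨l, hl, hchain⟩ := hF.exists_greedy hE (ω.map P.gen)
  have hl' : (l.map F).prod = (F D * F D) ^ n * b := by
    rw [hl, hω, List.map_map]
    congr 2
    funext α
    exact hFgen α
  set l' := List.replicate (2 * n) D with hl'def
  have hlD : (l'.map F).prod = (F D * F D) ^ n := by
    rw [hl'def, List.map_replicate, List.prod_replicate, pow_mul, pow_two]
  have hprod : ((l.map Subtype.val).map M.simpleElement).prod =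
      ((l'.map Subtype.val).map M.simpleElement).prod := by
    have key : ∀ k : List P.coxeterSubgroup,
        ((k.map Subtype.val).map M.simpleElement).prod = φ (k.map F).prod := by
      intro k
      rw [map_list_prod, List.map_map, List.map_map]
      congr 2
      funext w
      exact (hφF w).symm
    rw [key, key, hl', hlD, map_mul, hb, mul_one]
  have hc1 : (l.map Subtype.val).IsChain fun v w => hW.absorb v w = 1 := by
    rw [List.isChain_map]
    exact hchain.imp fun v w hvw => hP.absorb_eq_one hvw
  have hc2 : (l'.map Subtype.val).IsChain fun v w => hW.absorb v w = 1 := by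
    rw [hl'def, List.map_replicate]
    exact List.isChain_replicate_of_rel _ (hW.absorb_longest hD _)
  have hseq := prod_simpleElement_injOn hD hc1 hc2 hprod
  have hcoe : ∀ (k : List P.coxeterSubgroup) (m : ℕ),
      toSeq (k.map Subtype.val) m = ((toSeq k m : P.coxeterSubgroup) : M.Group) := by
    intro k
    induction k with
    | nil => intro m; rfl
    | cons v k ih =>
      intro m
      cases m with
      | zero => rfl
      | succ m => exact ih m
  have hseq' : toSeq l = toSeq l' := funext fun m => Subtype.ext (by
    rw [← hcoe, ← hcoe, hseq])
  have := prod_map_eq_of_toSeq hF.map_one hseq'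
  rw [hl', hlD] at this
  exact mul_eq_left.mp this

end SphericalPartition

end CoxeterMatrix

/-- If `P` is an admissible partition of the Coxeter matrix `Γ` whose type is spherical, then
`s_α ↦ r_α` extends to an injective homomorphism from the Artin-Tits group of the type of `P` to
that of `Γ`; in other words the subgroup generated by the `r_α`, with these generators, is the
Artin-Tits system of that type. -/
theorem theorem3p4 {I : Type*} (Γ : CoxeterMatrix I) (P : CoxeterMatrix.SphericalPartition Γ)
    (hP : P.IsAdmissible) (hsph : P.type.IsSpherical) :
    (∃ φ : P.type.ArtinGroup →* Γ.ArtinGroup,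
      (∀ α, φ (P.type.artinGen α) = P.artinLongest α) ∧ Function.Injective φ) ∧
    (∃ e : P.type.ArtinGroup ≃* P.artinSubgroup,
      ∀ α, (e (P.type.artinGen α) : Γ.ArtinGroup) = P.artinLongest α) := by
  obtain ⟨φ, hφ⟩ := hP.exists_hom
  have hinj := hP.hom_injective hsph hφ
  refine ⟨⟨φ, hφ, hinj⟩, ?_⟩
  have hrange : φ.range = P.artinSubgroup := by
    have htop : Subgroup.closure (Set.range P.type.artinGen) = ⊤ :=
      PresentedGroup.closure_range_of _
    rw [MonoidHom.range_eq_map, ← htop, MonoidHom.map_closure, ← Set.range_comp]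
    congr 2
    funext α
    exact hφ α
  exact ⟨(MonoidHom.ofInjective hinj).trans (MulEquiv.subgroupCongr hrange), hφ⟩
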